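/- \textbf{Setting.} Let $N\ge 1$ be an integer and let $H=(h_{k,j})\in\mathbb{R}^{(N-1)\times(N-1)}$ be a lower triangular matrix ($h_{k,j}=0$ for $j>k$). Given $T\colon\mathbb{R}^d\to\mathbb{R}^d$ and $y_0\in\mathbb{R}^d$, the fixed-point algorithm represented by $H$ generates $$y_{k+1}=y_k-\sum_{j=0}^{k}h_{k+1,j+1}\,(y_j-Ty_j),\qquad k=0,\dots,N-2.$$ We say that $H$ \emph{attains the exact optimal worst-case rate in dimension $d$} if $$\|y_{N-1}-Ty_{N-1}\|^2\le\frac{4\|y_0-y_\star\|^2}{N^2}$$ for every nonexpansive $T\colon\mathbb{R}^d\to\mathbb{R}^d$ (Euclidean norm), every $y_0\in\mathbb{R}^d$ and every fixed point $y_\star$ of $T$. For $1\le m\le N-1$ let $$P(N-1,m;H)=\sum_{1\le j(1)\le i(1)<j(2)\le i(2)<\cdots<j(m)\le i(m)\le N-1}\ \prod_{r=1}^m h_{i(r),j(r)} .$$ The \emph{H-invariance conditions} are $P(N-1,m;H)=\frac1N\binom{N}{m+1}$ for $m=1,\dots,N-1$. For vectors $y_0,g_1,\dots,g_N\in\mathbb{R}^d$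 put $x_k=y_0-\sum_{i=1}^{k-1}\sum_{j=1}^{i}2h_{i,j}g_j-g_k$ for $k=1,\dots,N$. Consider real numbers $(\lambda_{k,j})_{1\le j<k\le N}$ such that the identity $$0=N\|g_N\|^2+\langle g_N,x_N-y_0\rangle+\sum_{k=1}^{N}\sum_{j=1}^{k-1}\lambda_{k,j}\langle x_k-x_j,\,g_k-g_j\rangle \tag{$*$}$$ holds identically, i.e. for all $d$ and all $y_0,g_1,\dots,g_N\in\mathbb{R}^d$. \textbf{Theorem.} (0) If $H$ satisfies the H-invariance conditions, then there are unique real numbers $\lambda_{k,j}$ ($1\le j<k\le N$) satisfying $(*)$. They are called the \emph{H-certificates} $\lambda^\star_{k,j}(H)$. (1) $H$ attains the exact optimal worst-case rate in every dimension $d$ if and only if $$\begin{cases}P(N-1,m;H)=\frac1N\binom{N}{m+1}, & m=1,\dots,N-1,\\[2pt] \lambda^\star_{k,j}(H)\ge 0, & k=2,\dots,N,\ j=1,\dots,k-1.\end{cases}$$ (2) For each fixed dimension $d\ge N+1$, $H$ attains the exact optimal worst-case rate in dimension $d$ if and only if the same conditions hold. -/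

import Mathlib

noncomputable section

namespace HMatrix

/-- The entry `h_{k,j}` (indices starting from `1`) of the lower triangular H-matrix
`H` of size `(N-1) × (N-1)`; it is `0` when `1 ≤ j ≤ k ≤ N-1` fails. -/
def entry {N : ℕ} (H : Matrix (Fin (N - 1)) (Fin (N - 1)) ℝ) (k j : ℕ) : ℝ :=
  if hkj : 1 ≤ j ∧ j ≤ k ∧ k ≤ N - 1 then
    H ⟨k - 1, by omega⟩ ⟨j - 1, by omega⟩
  else 0

/-- The iterates of the algorithm with H-matrix `H` applied to the operator `T` from `y₀`:
`y_{k+1} = y_k - ∑_{j=0}^{k} h_{k+1,j+1} (y_j - T y_j)`. -/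
def iter {N : ℕ} (H : Matrix (Fin (N - 1)) (Fin (N - 1)) ℝ)
    {E : Type*} [AddCommGroup E] [Module ℝ E] (T : E → E) (y₀ : E) : ℕ → E
  | 0 => y₀
  | k + 1 => iter H T y₀ k -
      ∑ j : Fin (k + 1), entry H (k + 1) (j + 1) • (iter H T y₀ j - T (iter H T y₀ j))
  decreasing_by all_goals omega

/-- The algorithm with H-matrix `H` has the worst-case rate
`‖y_{N-1} - T y_{N-1}‖² ≤ 4 ‖y₀ - y⋆‖² / N²` over all nonexpansive `T : ℝᵈ → ℝᵈ`,
all starting points `y₀` and all fixed points `y⋆` of `T`. -/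
def HasOptimalRate (N d : ℕ) (H : Matrix (Fin (N - 1)) (Fin (N - 1)) ℝ) : Prop :=
  ∀ T : EuclideanSpace ℝ (Fin d) → EuclideanSpace ℝ (Fin d),
    (∀ x y, ‖T x - T y‖ ≤ ‖x - y‖) →
    ∀ y₀ yStar : EuclideanSpace ℝ (Fin d), T yStar = yStar →
      ‖iter H T y₀ (N - 1) - T (iter H T y₀ (N - 1))‖ ^ 2 ≤ 4 * ‖y₀ - yStar‖ ^ 2 / (N : ℝ) ^ 2

/-- The index set of `P(k,m;·)`: families `r ↦ (i(r), j(r))` of pairs of indices with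
`1 ≤ j(1) ≤ i(1) < j(2) ≤ i(2) < ⋯ < j(m) ≤ i(m) ≤ k`. -/
def indexSet (k m : ℕ) : Finset (Fin m → ℕ × ℕ) :=
  (Fintype.piFinset fun _ : Fin m => Finset.Icc 1 k ×ˢ Finset.Icc 1 k).filter fun p =>
    (∀ r, (p r).2 ≤ (p r).1) ∧
      ∀ r s : Fin m, (r : ℕ) + 1 = (s : ℕ) → (p r).1 < (p s).2

/-- The polynomial `P(k,m;H) = ∑ ∏_{r=1}^{m} h_{i(r),j(r)}`. The H-invariants of `H` are
the values `P(N-1,m;H)`, `m = 1,…,N-1`. -/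
def P {N : ℕ} (H : Matrix (Fin (N - 1)) (Fin (N - 1)) ℝ) (k m : ℕ) : ℝ :=
  ∑ p ∈ indexSet k m, ∏ r, entry H (p r).1 (p r).2

/-- The H-invariance conditions `P(N-1,m;H) = (1/N) * (N choose (m+1))`, `m = 1,…,N-1`. -/
def Invariance (N : ℕ) (H : Matrix (Fin (N - 1)) (Fin (N - 1)) ℝ) : Prop :=
  ∀ m : ℕ, 1 ≤ m → m ≤ N - 1 → P H (N - 1) m = 1 / (N : ℝ) * (N.choose (m + 1) : ℝ)

/-- `y_k = y₀ - ∑_{i=1}^{k} ∑_{j=1}^{i} 2 h_{i,j} g_j`, as an expression in free vectors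
`y₀, g_1, g_2, …`. -/
def formalY {N : ℕ} (H : Matrix (Fin (N - 1)) (Fin (N - 1)) ℝ)
    {E : Type*} [AddCommGroup E] [Module ℝ E] (y₀ : E) (g : ℕ → E) (k : ℕ) : E :=
  y₀ - ∑ i ∈ Finset.Icc 1 k, ∑ j ∈ Finset.Icc 1 i, (2 * entry H i j) • g j

/-- `x_k = y_{k-1} - g_k` (for `k ≥ 1`), as an expression in free vectors. -/
def formalX {N : ℕ} (H : Matrix (Fin (N - 1)) (Fin (N - 1)) ℝ)
    {E : Type*} [AddCommGroup E] [Module ℝ E] (y₀ : E) (g : ℕ → E) (k : ℕ) : E :=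
  formalY H y₀ g (k - 1) - g k

/-- The multipliers `lam k j` (`1 ≤ j < k ≤ N`) satisfy the identity
`0 = N ‖g_N‖² + ⟪g_N, x_N - y₀⟫ + ∑_{k=1}^{N} ∑_{j=1}^{k-1} lam k j ⟪x_k - x_j, g_k - g_j⟫`
identically in the free vectors `y₀, g_1, …, g_N`, i.e. as an identity between formal
quadratic forms. Values of `lam` at other indices play no role. -/
def IsCertificate (N : ℕ) (H : Matrix (Fin (N - 1)) (Fin (N - 1)) ℝ)
    (lam : ℕ → ℕ → ℝ) : Prop :=
  ∀ (d : ℕ) (y₀ : EuclideanSpace ℝ (Fin d)) (g : ℕ → EuclideanSpace ℝ (Fin d)),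
    0 = (N : ℝ) * ‖g N‖ ^ 2 + inner ℝ (g N) (formalX H y₀ g N - y₀) +
      ∑ k ∈ Finset.Icc 1 N, ∑ j ∈ Finset.Icc 1 (k - 1),
        lam k j * inner ℝ (formalX H y₀ g k - formalX H y₀ g j) (g k - g j)

open Classical in
/-- The H-certificates `λ⋆_{k,j}(H)`, `1 ≤ j < k ≤ N`: the values satisfying the identity of
`IsCertificate`. (That under the H-invariance conditions such values exist and are unique is
asserted by the main theorem.) -/
def certificate (N : ℕ) (H : Matrix (Fin (N - 1)) (Fin (N - 1)) ℝ) : ℕ → ℕ → ℝ :=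
  if hex : ∃ lam : ℕ → ℕ → ℝ, IsCertificate N H lam then hex.choose else 0

/-- The H-invariance conditions hold and all H-certificates are nonnegative. -/
def OptimalityConditions (N : ℕ) (H : Matrix (Fin (N - 1)) (Fin (N - 1)) ℝ) : Prop :=
  Invariance N H ∧
    ∀ k j : ℕ, 2 ≤ k → k ≤ N → 1 ≤ j → j ≤ k - 1 → 0 ≤ certificate N H k j

end HMatrix

end

/-! Write `y_{k-1} - T y_{k-1} = 2 g_k`. Then `x_k` is the midpoint of `y_{k-1}` and `T y_{k-1}`,
and nonexpansiveness of `T` says exactly that all `⟪x_k - x_j, g_k - g_j⟫` are nonnegative. With `M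
= 1 + stepMatrix H` one has `x = y₀ - M g`. Encoding the multipliers as a symmetric matrix `L` with
zero row sums, and writing `E` for the matrix unit at the last diagonal place, the identity (*)
becomes the Lyapunov equation `Mᵀ S + S M = 2 N E` for `S = L + E`. Since `M` is unipotent the
solution is unique, and it is explicit. Its row sums have the required values under the H-invariance
conditions, because `stepMatrix H ^ m` applied to the all-ones vector produces the numbers `P(i,m)`.
This gives the certificates.

Sufficiency: with nonnegative multipliers (*) yields `N ‖g_N‖² ≤ ⟪g_N, y₀ - y⋆⟫`, and Cauchy–Schwarz
finishes.

Necessity uses a negacyclic shift `T` of `N` orthonormal vectors, available once `d ≥ N`. There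
`g_N` is a polynomial in `T` applied to `e`, with coefficient sum `1`; the rate bounds the sum of
squared coefficients by `1/N`, so all of them equal `1/N`, which is H-invariance
(`HasOptimalRate.invariance`). On this example every slack is zero and the `g_k` are linearly
independent. If some multiplier were negative, a small perturbation would make all slacks positive
and violate the rate (`HasOptimalRate.certificate_nonneg`); by Kirszbraun's theorem the perturbed
vectors still come from a nonexpansive operator. -/

/-! ### Kirszbraun's extension theorem for finitely many points. -/

section Kirszbraun

open Finset Topology

variable {ι E F : Type*} [NormedAddCommGroup E] [InnerProductSpace ℝ E]
  [NormedAddCommGroup F] [InnerProductSpace ℝ F]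

/-- The variance of a finitely supported distribution through pairwise distances. -/
theorem sum_sum_mul_norm_sub_sq [Fintype ι] (μ : ι → ℝ) (hμ : ∑ i, μ i = 1) (c : ι → E) :
    ∑ i, ∑ j, μ i * μ j * ‖c i - c j‖ ^ 2 =
      2 * (∑ i, μ i * ‖c i‖ ^ 2 - ‖∑ i, μ i • c i‖ ^ 2) := by
  have h1 : ‖∑ i, μ i • c i‖ ^ 2 = ∑ i, ∑ j, μ i * μ j * inner ℝ (c i) (c j) := by
    rw [← real_inner_self_eq_norm_sq, sum_inner]
    refine sum_congr rfl fun i _ => ?_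
    rw [inner_sum]
    refine sum_congr rfl fun j _ => ?_
    rw [real_inner_smul_left, real_inner_smul_right]
    ring
  have h2 : ∑ i, ∑ j, μ i * μ j * ‖c i‖ ^ 2 = ∑ i, μ i * ‖c i‖ ^ 2 := by
    refine sum_congr rfl fun i _ => ?_
    rw [← sum_mul, ← mul_sum, hμ, mul_one]
  have h3 : ∑ i, ∑ j, μ i * μ j * ‖c j‖ ^ 2 = ∑ i, μ i * ‖c i‖ ^ 2 := by
    rw [sum_comm, ← h2]
    refine sum_congr rfl fun i _ => sum_congr rfl fun j _ => by ring
  have h4 : ∀ i j, μ i * μ j * ‖c i - c j‖ ^ 2 = μ i * μ j * ‖c i‖ ^ 2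
      + μ i * μ j * ‖c j‖ ^ 2 - 2 * (μ i * μ j * inner ℝ (c i) (c j)) := by
    intro i j
    rw [norm_sub_sq_real]
    ring
  simp_rw [h4, sum_sub_distrib, sum_add_distrib, ← mul_sum, h2, h3, ← h1]
  ring

/-- A nonexpansive map from a finite set extends to one further point. -/
theorem exists_norm_sub_le_of_finite [Fintype ι] (a : ι → E) (b : ι → F)
    (h : ∀ i j, ‖b i - b j‖ ≤ ‖a i - a j‖) (p : E) : ∃ q : F, ∀ i, ‖q - b i‖ ≤ ‖p - a i‖ := by
  classical
  rcases isEmpty_or_nonempty ι with hι | ⟨⟨i₀⟩⟩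
  · exact ⟨0, fun i => hι.elim i⟩
  let κ : ι → ℝ := fun i => ‖b i‖ ^ 2 - ‖p - a i‖ ^ 2
  -- Dual function of minimizing over `q` the maximum of `‖q - b i‖² - ‖p - a i‖²`; the primal point
  -- is the barycenter of the `b i` at a maximizer.
  let φ : (ι → ℝ) → ℝ := fun μ => ∑ i, μ i * κ i - ‖∑ i, μ i • b i‖ ^ 2
  have hφc : Continuous φ := by fun_prop
  obtain ⟨μ, hμ, hmax⟩ := (isCompact_stdSimplex ℝ ι).exists_isMaxOn
    ⟨_, single_mem_stdSimplex ℝ i₀⟩ hφc.continuousOn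
  -- Twice the `μ`-variance of `b` is at most that of `p - a`, by comparing pairwise distances.
  have hφ : φ μ ≤ 0 := by
    have e1 := sum_sum_mul_norm_sub_sq μ hμ.2 b
    have e2 := sum_sum_mul_norm_sub_sq μ hμ.2 fun i => p - a i
    have e3 : ∑ i, ∑ j, μ i * μ j * ‖b i - b j‖ ^ 2 ≤
        ∑ i, ∑ j, μ i * μ j * ‖(p - a i) - (p - a j)‖ ^ 2 := by
      refine sum_le_sum fun i _ => sum_le_sum fun j _ => ?_
      have : ‖(p - a i) - (p - a j)‖ = ‖a i - a j‖ := by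
        rw [sub_sub_sub_cancel_left, norm_sub_rev]
      rw [this]
      have := h i j
      have := hμ.1 i
      have := hμ.1 j
      gcongr
    have e4 : φ μ = (∑ i, μ i * ‖b i‖ ^ 2 - ‖∑ i, μ i • b i‖ ^ 2) -
        ∑ i, μ i * ‖p - a i‖ ^ 2 := by
      simp only [φ, κ, mul_sub, sum_sub_distrib]
      ring
    have := sq_nonneg ‖∑ i, μ i • (p - a i)‖
    linarith
  set q := ∑ i, μ i • b i with hq
  refine ⟨q, fun i => ?_⟩
  set κ₀ := ∑ j, μ j * κ j with hκ₀
  -- First-order optimality of `μ` when moving towards the vertex `i` of the simplex; letting `t →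
  -- 0` removes the right-hand side.
  have key : ∀ t : ℝ, 0 < t → t ≤ 1 →
      κ i - κ₀ - 2 * inner ℝ q (b i - q) ≤ t * ‖b i - q‖ ^ 2 := by
    intro t ht ht1
    set e : ι → ℝ := Pi.single i 1 with he
    have hmem : (1 - t) • μ + t • e ∈ stdSimplex ℝ ι :=
      convex_stdSimplex ℝ ι hμ (single_mem_stdSimplex ℝ i) (by linarith) ht.le (by ring)
    have hle : φ ((1 - t) • μ + t • e) ≤ φ μ := hmax hmem
    have e1 : ∑ j, ((1 - t) • μ + t • e) j * κ j = (1 - t) * κ₀ + t * κ i := by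
      simp [he, add_mul, sum_add_distrib, Pi.single_apply, hκ₀, mul_sum, mul_assoc]
    have e2 : ∑ j, ((1 - t) • μ + t • e) j • b j = q + t • (b i - q) := by
      simp only [Pi.add_apply, Pi.smul_apply, smul_eq_mul, add_smul, sum_add_distrib, mul_smul,
        ← smul_sum, ← hq, he, Pi.single_apply, ite_smul, zero_smul, one_smul, sum_ite_eq', mem_univ,
        if_true]
      module
    have e3 : φ ((1 - t) • μ + t • e) =
        (1 - t) * κ₀ + t * κ i - ‖q + t • (b i - q)‖ ^ 2 := by
      simp only [φ, e1, e2]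
    have e4 : φ μ = κ₀ - ‖q‖ ^ 2 := rfl
    rw [e3, e4, norm_add_sq_real, real_inner_smul_right, norm_smul, mul_pow, Real.norm_eq_abs,
      sq_abs] at hle
    have : t * (κ i - κ₀ - 2 * inner ℝ q (b i - q)) ≤ t * (t * ‖b i - q‖ ^ 2) := by linarith
    exact le_of_mul_le_mul_left this ht
  have key0 : κ i - κ₀ - 2 * inner ℝ q (b i - q) ≤ 0 := by
    have hlim : Filter.Tendsto (fun t : ℝ => t * ‖b i - q‖ ^ 2) (𝓝[>] 0) (𝓝 0) := by
      have : Continuous fun t : ℝ => t * ‖b i - q‖ ^ 2 := by fun_prop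
      simpa using (this.tendsto 0).mono_left nhdsWithin_le_nhds
    refine ge_of_tendsto hlim ?_
    filter_upwards [Ioc_mem_nhdsGT (zero_lt_one' ℝ)] with t ht using key t ht.1 ht.2
  have e4 : φ μ = κ₀ - ‖q‖ ^ 2 := rfl
  refine le_of_sq_le_sq ?_ (norm_nonneg _)
  rw [norm_sub_sq_real]
  rw [inner_sub_right, real_inner_self_eq_norm_sq] at key0
  simp only [κ] at key0
  linarith

/-- Nonexpansive maps from a finite set extend to finitely many further points. -/
theorem exists_finset_nonexpansive_extension [Finite ι] (a : ι → E) (b : ι → F)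
    (h : ∀ i j, ‖b i - b j‖ ≤ ‖a i - a j‖) (s : Finset E) :
    ∃ f : E → F, (∀ x ∈ s, ∀ i, ‖f x - b i‖ ≤ ‖x - a i‖) ∧
      ∀ x ∈ s, ∀ y ∈ s, ‖f x - f y‖ ≤ ‖x - y‖ := by
  classical
  cases nonempty_fintype ι
  induction s using Finset.induction_on with
  | empty => exact ⟨0, by simp⟩
  | insert p s hp ih =>
    obtain ⟨f, hf1, hf2⟩ := ih
    obtain ⟨q, hq⟩ := exists_norm_sub_le_of_finite (ι := ι ⊕ s)
      (Sum.elim a fun x => (x : E)) (Sum.elim b fun x => f x) (by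
        rintro (i | x) (j | y)
        · exact h i j
        · simpa [norm_sub_rev] using hf1 y y.2 i
        · exact hf1 x x.2 j
        · exact hf2 x x.2 y y.2) p
    have hq1 : ∀ i, ‖q - b i‖ ≤ ‖p - a i‖ := fun i => hq (Sum.inl i)
    have hq2 : ∀ x ∈ s, ‖q - f x‖ ≤ ‖p - x‖ := fun x hx => hq (Sum.inr ⟨x, hx⟩)
    have hne : ∀ x ∈ s, x ≠ p := fun x hx e => hp (e ▸ hx)
    refine ⟨Function.update f p q, ?_, ?_⟩
    · intro x hx i
      rcases Finset.mem_insert.1 hx with rfl | hx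
      · simpa using hq1 i
      · simpa [hne x hx] using hf1 x hx i
    · intro x hx y hy
      rcases Finset.mem_insert.1 hx with rfl | hx' <;>
        rcases Finset.mem_insert.1 hy with rfl | hy'
      · simp
      · simpa [hne y hy'] using hq2 y hy'
      · simpa [hne x hx', norm_sub_rev] using hq2 x hx'
      · simpa [hne x hx', hne y hy'] using hf2 x hx' y hy'

/-- Kirszbraun's theorem for nonexpansive maps defined on a finite set. -/
theorem exists_nonexpansive_extension [Finite ι] [ProperSpace F] (a : ι → E) (b : ι → F)
    (h : ∀ i j, ‖b i - b j‖ ≤ ‖a i - a j‖) :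
    ∃ T : E → F, (∀ x y, ‖T x - T y‖ ≤ ‖x - y‖) ∧ ∀ i, T (a i) = b i := by
  classical
  rcases isEmpty_or_nonempty ι with hι | ⟨⟨i₀⟩⟩
  · exact ⟨0, by simp, fun i => hι.elim i⟩
  -- Tychonoff: any extension must lie in this product of balls, and each finite set of constraints
  -- is satisfiable inside it.
  let K : Set (E → F) := Set.univ.pi fun x => Metric.closedBall (b i₀) ‖x - a i₀‖
  have hK : IsCompact K := isCompact_univ_pi fun x => isCompact_closedBall _ _
  let C : Finset E → Set (E → F) := fun s =>
    {f | (∀ x ∈ s, ∀ i, ‖f x - b i‖ ≤ ‖x - a i‖) ∧ ∀ x ∈ s, ∀ y ∈ s, ‖f x - f y‖ ≤ ‖x - y‖}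
  have hC : ∀ s, IsClosed (C s) := by
    intro s
    simp only [C, Set.ofPred_and, Set.ofPred_forall]
    refine IsClosed.inter ?_ ?_
    · exact isClosed_iInter fun x => isClosed_iInter fun _ => isClosed_iInter fun i =>
        isClosed_le (by fun_prop) (by fun_prop)
    · exact isClosed_iInter fun x => isClosed_iInter fun _ => isClosed_iInter fun y =>
        isClosed_iInter fun _ => isClosed_le (by fun_prop) (by fun_prop)
  have hne : (⋂ s, K ∩ C s).Nonempty := by
    refine IsCompact.nonempty_iInter_of_directed_nonempty_isCompact_isClosed _ ?_ ?_
      (fun s => hK.inter_right (hC s)) (fun s => hK.isClosed.inter (hC s))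
    · intro s t
      refine ⟨s ∪ t, ?_, ?_⟩ <;> rintro f ⟨hfK, hf1, hf2⟩
      · exact ⟨hfK, fun x hx => hf1 x (mem_union_left _ hx), fun x hx y hy =>
          hf2 x (mem_union_left _ hx) y (mem_union_left _ hy)⟩
      · exact ⟨hfK, fun x hx => hf1 x (mem_union_right _ hx), fun x hx y hy =>
          hf2 x (mem_union_right _ hx) y (mem_union_right _ hy)⟩
    · intro s
      obtain ⟨f, hf1, hf2⟩ := exists_finset_nonexpansive_extension a b h s
      -- Outside `s` only membership in the ball is required, so its center serves as default value.
      refine ⟨fun x => if x ∈ s then f x else b i₀, ?_, ?_, ?_⟩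
      · intro x _
        by_cases hx : x ∈ s
        · simpa [hx, dist_eq_norm] using hf1 x hx i₀
        · simp [hx]
      · intro x hx i
        simpa [hx] using hf1 x hx i
      · intro x hx y hy
        simpa [hx, hy] using hf2 x hx y hy
  obtain ⟨T, hT⟩ := hne
  rw [Set.mem_iInter] at hT
  refine ⟨T, fun x y => (hT {x, y}).2.2 x (by simp) y (by simp), fun i => ?_⟩
  have := (hT {a i}).2.1 (a i) (by simp) i
  rw [sub_self, norm_zero] at this
  exact sub_eq_zero.1 (norm_le_zero_iff.1 this)

end Kirszbraun

namespace HMatrix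

open Finset

/-! ### The polynomials `P(k,m)` as powers of a nilpotent matrix. -/

section Combinatorics

theorem sum_Icc_one_eq_sum_fin {E : Type*} [AddCommMonoid E] (N : ℕ) (f : ℕ → E) :
    ∑ k ∈ Icc 1 N, f k = ∑ i : Fin N, f (i + 1) := by
  rw [Fin.sum_univ_eq_sum_range (fun i => f (i + 1)), range_eq_Ico, sum_Ico_add' f 0 N 1]
  rfl

theorem sum_Icc_sum_Icc_eq {E : Type*} [AddCommMonoid E] {N i : ℕ} (hi : i ≤ N)
    (f : ℕ → ℕ → E) :
    ∑ k ∈ Icc 1 i, ∑ l ∈ Icc 1 k, f k l = ∑ j : Fin N, ∑ k ∈ Icc (j + 1 : ℕ) i, f k (j + 1) := by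
  rw [← sum_Icc_one_eq_sum_fin N fun l => ∑ k ∈ Icc l i, f k l]
  refine sum_comm' fun k l => ?_
  simp only [mem_Icc]
  omega

theorem mem_indexSet {k m : ℕ} {p : Fin m → ℕ × ℕ} :
    p ∈ indexSet k m ↔ (∀ r, 1 ≤ (p r).2 ∧ (p r).2 ≤ (p r).1 ∧ (p r).1 ≤ k) ∧
      ∀ r s : Fin m, (r : ℕ) + 1 = (s : ℕ) → (p r).1 < (p s).2 := by
  simp only [indexSet, mem_filter, Fintype.mem_piFinset, mem_product, mem_Icc]
  constructor
  · rintro ⟨h1, h2, h3⟩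
    exact ⟨fun r => ⟨(h1 r).2.1, h2 r, (h1 r).1.2⟩, h3⟩
  · rintro ⟨h1, h2⟩
    refine ⟨fun r => ?_, fun r => (h1 r).2.1, h2⟩
    have := h1 r
    omega

theorem mem_indexSet_succ {k m : ℕ} {p : Fin (m + 1) → ℕ × ℕ} :
    p ∈ indexSet k (m + 1) ↔ (1 ≤ (p (Fin.last m)).2 ∧ (p (Fin.last m)).2 ≤ (p (Fin.last m)).1 ∧
      (p (Fin.last m)).1 ≤ k) ∧
      (fun r : Fin m => p r.castSucc) ∈ indexSet ((p (Fin.last m)).2 - 1) m := by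
  simp only [mem_indexSet]
  constructor
  · rintro ⟨h1, h2⟩
    refine ⟨h1 _, fun r => ⟨(h1 _).1, (h1 _).2.1, ?_⟩, fun r s hrs => h2 _ _ (by simpa using hrs)⟩
    -- The definition orders neighbouring pairs only; chaining shows that all earlier pairs lie
    -- strictly below the last one.
    have hmono : ∀ d : ℕ, ∀ r s : Fin (m + 1), (r : ℕ) + d + 1 = s → (p r).1 < (p s).2 := by
      intro d
      induction d with
      | zero => exact fun r s hrs => h2 r s hrs
      | succ d ih =>
        intro r s hrs
        have := ih r ⟨r + d + 1, by omega⟩ rfl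
        have h3 := h1 ⟨r + d + 1, by omega⟩
        have := h2 ⟨r + d + 1, by omega⟩ s (by simpa using by omega)
        omega
    have := hmono (m - 1 - r) r.castSucc (Fin.last m) (by simp; omega)
    omega
  · rintro ⟨h1, h2, h3⟩
    refine ⟨fun r => ?_, fun r s hrs => ?_⟩
    · induction r using Fin.lastCases with
      | last => exact h1
      | cast r => have := h2 r; omega
    · have hr : (r : ℕ) < m := by omega
      obtain ⟨r, rfl⟩ : ∃ r' : Fin m, r = r'.castSucc := ⟨⟨r, hr⟩, rfl⟩
      induction s using Fin.lastCases with
      | last => have := h2 r; omega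
      | cast s => exact h3 r s (by simpa using hrs)

variable {N : ℕ} (H : Matrix (Fin (N - 1)) (Fin (N - 1)) ℝ)

@[simp] theorem P_zero (k : ℕ) : P H k 0 = 1 := by
  have : indexSet k 0 = univ := by
    refine eq_univ_iff_forall.2 fun p => mem_indexSet.2 ⟨fun r => r.elim0, fun r => r.elim0⟩
  simp [P, this]

/-- Splits off the last pair `(i, j)`; the remaining pairs are confined to indices at most `j - 1`.
-/
theorem P_succ (k m : ℕ) :
    P H k (m + 1) = ∑ i ∈ Icc 1 k, ∑ j ∈ Icc 1 i, entry H i j * P H (j - 1) m := by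
  simp only [P, mul_sum, sum_sigma']
  refine sum_bij' (fun p _ => ⟨(p (Fin.last m)).1, (p (Fin.last m)).2, fun r => p r.castSucc⟩)
    (fun x _ => Fin.snoc (α := fun _ => ℕ × ℕ) x.2.2 (x.1, x.2.1)) ?_ ?_ ?_ ?_ ?_
  · intro p hp
    rw [mem_indexSet_succ] at hp
    simp only [mem_sigma, mem_Icc]
    refine ⟨⟨?_, ?_⟩, ⟨?_, ?_⟩, hp.2⟩ <;> omega
  · rintro ⟨i, j, p⟩ hx
    simp only [mem_sigma, mem_Icc] at hx
    rw [mem_indexSet_succ]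
    simp only [Fin.snoc_last, Fin.snoc_castSucc]
    refine ⟨⟨?_, ?_, ?_⟩, hx.2.2⟩ <;> omega
  · intro p _
    ext r : 1
    induction r using Fin.lastCases <;> simp
  · rintro ⟨i, j, p⟩ _
    simp
  · intro p _
    rw [Fin.prod_univ_castSucc, mul_comm]

theorem P_eq_zero_of_lt {k m : ℕ} (h : k < m) : P H k m = 0 := by
  induction m generalizing k with
  | zero => omega
  | succ m ih =>
    rw [P_succ]
    refine sum_eq_zero fun i hi => sum_eq_zero fun j hj => ?_
    rw [mem_Icc] at hi hj
    rw [ih (by omega), mul_zero]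

theorem P_self_succ (k : ℕ) : P H (k + 1) (k + 1) = entry H (k + 1) (k + 1) * P H k k := by
  rw [P_succ, sum_Icc_succ_top (by omega), sum_Icc_succ_top (by omega), add_tsub_cancel_right]
  rw [sum_eq_zero, sum_eq_zero, zero_add, zero_add]
  · intro j hj
    rw [mem_Icc] at hj
    rw [P_eq_zero_of_lt H (by omega), mul_zero]
  · intro i hi
    refine sum_eq_zero fun j hj => ?_
    rw [mem_Icc] at hi hj
    rw [P_eq_zero_of_lt H (by omega), mul_zero]

theorem P_self_ne_zero {k m : ℕ} (h : P H m m ≠ 0) (hk : k ≤ m) : P H k k ≠ 0 := by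
  induction m, hk using Nat.le_induction with
  | base => exact h
  | succ m _ ih =>
    rw [P_self_succ] at h
    exact ih (right_ne_zero_of_mul h)

/-- The strictly lower triangular matrix `A` with
`y_i = y₀ - ∑_j A i j • g_{j+1}` for `i < N`. -/
noncomputable def stepMatrix : Matrix (Fin N) (Fin N) ℝ :=
  Matrix.of fun i j => ∑ k ∈ Icc (j + 1 : ℕ) i, 2 * entry H k (j + 1)

theorem stepMatrix_apply (i j : Fin N) :
    stepMatrix H i j = ∑ k ∈ Icc (j + 1 : ℕ) i, 2 * entry H k (j + 1) := rfl

theorem stepMatrix_eq_zero {i j : Fin N} (h : i ≤ j) : stepMatrix H i j = 0 := by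
  rw [stepMatrix_apply, Icc_eq_empty (by have : (i : ℕ) ≤ j := h; omega), sum_empty]

theorem formalY_eq {E : Type*} [AddCommGroup E] [Module ℝ E] (y₀ : E) (g : ℕ → E) (i : Fin N) :
    formalY H y₀ g i = y₀ - ∑ j : Fin N, stepMatrix H i j • g (j + 1) := by
  rw [formalY, sum_Icc_sum_Icc_eq i.2.le]
  simp only [stepMatrix_apply, sum_smul]

theorem formalX_eq {E : Type*} [AddCommGroup E] [Module ℝ E] (y₀ : E) (g : ℕ → E) (i : Fin N) :
    formalX H y₀ g (i + 1) = y₀ - ∑ j : Fin N, (1 + stepMatrix H) i j • g (j + 1) := by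
  simp only [formalX, add_tsub_cancel_right, formalY_eq, Matrix.add_apply, add_smul,
    sum_add_distrib, Matrix.one_apply, ite_smul, one_smul, zero_smul, sum_ite_eq, mem_univ, if_true]
  abel

/-- The link between H-invariants and linear algebra: one multiplication by the step matrix is the
recursion `P_succ`, with a factor `2` from `2 h`. -/
theorem stepMatrix_pow_mulVec_one (m : ℕ) (i : Fin N) :
    (stepMatrix H ^ m).mulVec 1 i = 2 ^ m * P H i m := by
  induction m generalizing i with
  | zero => simp
  | succ m ih =>
    rw [pow_succ', ← Matrix.mulVec_mulVec, P_succ, sum_Icc_sum_Icc_eq i.2.le]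
    simp only [Matrix.mulVec, dotProduct] at ih ⊢
    simp only [ih, stepMatrix_apply, sum_mul, mul_sum, add_tsub_cancel_right]
    refine sum_congr rfl fun j _ => sum_congr rfl fun k _ => by ring

theorem pow_eq_zero_of_strictLower {N : ℕ} {A : Matrix (Fin N) (Fin N) ℝ}
    (hA : ∀ i j, i ≤ j → A i j = 0) : A ^ N = 0 := by
  have key : ∀ (n : ℕ) (i j : Fin N), (i : ℕ) < j + n → (A ^ n) i j = 0 := by
    intro n
    induction n with
    | zero =>
      intro i j hij
      rw [pow_zero, Matrix.one_apply_ne]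
      rintro rfl
      omega
    | succ n ih =>
      intro i j hij
      rw [pow_succ, Matrix.mul_apply]
      refine sum_eq_zero fun k _ => ?_
      by_cases hk : k ≤ j
      · rw [hA _ _ hk, mul_zero]
      · have : (j : ℕ) < k := not_le.1 hk
        rw [ih i k (by omega), zero_mul]
  ext i j
  exact key N i j (by omega)

theorem stepMatrix_pow_eq_zero : stepMatrix H ^ N = 0 :=
  pow_eq_zero_of_strictLower fun _ _ h => stepMatrix_eq_zero H h

end Combinatorics

/-! ### Lyapunov equations with unipotent coefficients. -/

section Lyapunov

variable {ι : Type*} [Fintype ι] [DecidableEq ι]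

/-- The equation reads `A X = -X (2 + B)`. Iterating moves powers of the nilpotent `A` across to
powers of the invertible `2 + B`. -/
theorem eq_zero_of_lyapunov {A B X : Matrix ι ι ℝ} (hA : IsNilpotent A) (hB : IsNilpotent B)
    (h : (1 + A) * X + X * (1 + B) = 0) : X = 0 := by
  have hu : IsUnit (-(2 + B)) := by
    have h2 : IsUnit (2 : Matrix ι ι ℝ) := by
      have := (IsUnit.mk0 (2 : ℝ) two_ne_zero).map (algebraMap ℝ (Matrix ι ι ℝ))
      rwa [map_ofNat] at this
    exact (hB.isUnit_add_left_of_commute h2 (Nat.cast_commute 2 B).symm).neg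
  have h1 : A * X = X * -(2 + B) := by
    have : A * X - X * -(2 + B) = (1 + A) * X + X * (1 + B) := by noncomm_ring
    rw [← sub_eq_zero, this, h]
  obtain ⟨n, hn⟩ := hA
  have h2 : ∀ m : ℕ, A ^ m * X = X * (-(2 + B)) ^ m := by
    intro m
    induction m with
    | zero => simp
    | succ m ih => rw [pow_succ, mul_assoc, h1, ← mul_assoc, ih, mul_assoc, pow_succ]
  have h3 := h2 n
  rw [hn, zero_mul] at h3
  exact ((hu.pow n).mul_left_eq_zero).1 h3.symm

/-- A Lyapunov equation with unipotent coefficient and symmetric right-hand side has a symmetric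
solution. -/
theorem exists_isSymm_lyapunov {A Q : Matrix ι ι ℝ} (hA : IsNilpotent A) (hQ : Q.IsSymm) :
    ∃ X : Matrix ι ι ℝ, X.IsSymm ∧ (1 + A) * X + X * (1 + A).transpose = Q := by
  have hAt : IsNilpotent A.transpose := by
    obtain ⟨n, hn⟩ := hA
    exact ⟨n, by rw [← Matrix.transpose_pow, hn, Matrix.transpose_zero]⟩
  let Φ : Matrix ι ι ℝ →ₗ[ℝ] Matrix ι ι ℝ :=
    LinearMap.mulLeft ℝ (1 + A) + LinearMap.mulRight ℝ (1 + A).transpose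
  have hΦ : ∀ X, Φ X = (1 + A) * X + X * (1 + A).transpose := fun X => rfl
  have hinj : Function.Injective Φ := by
    refine (injective_iff_map_eq_zero Φ).2 fun X hX => ?_
    rw [hΦ, Matrix.transpose_add, Matrix.transpose_one] at hX
    exact eq_zero_of_lyapunov hA hAt hX
  obtain ⟨X, hX⟩ := (LinearMap.injective_iff_surjective.1 hinj) Q
  -- As `Q` is symmetric, `Xᵀ` solves the same equation, so injectivity forces `Xᵀ = X`.
  refine ⟨X, hinj ?_, hX⟩
  rw [hX, hΦ, ← hQ, ← hX, hΦ]
  simp only [Matrix.transpose_add, Matrix.transpose_mul, Matrix.transpose_transpose,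
    Matrix.transpose_one]
  abel

end Lyapunov

/-! ### Explicit solution of the Lyapunov equation. -/

section Solution

open Polynomial in
theorem sum_neg_one_pow_mul_choose_mul_choose {N a : ℕ} (ha : a < N) :
    ∑ b ∈ range N, (-1 : ℝ) ^ b * (a + b).choose a * N.choose (b + 1) = if a = 0 then 1 else 0 := by
  -- Binomial expansion of `(1 - (X + 1))^N`. For positive `a`, multiply by `(X + 1)^(a - 1)` and
  -- read off the coefficient of `X^a`: both terms on the right contribute zero.
  have key : (X + 1 : ℝ[X]) * ∑ b ∈ range N, C ((-1 : ℝ) ^ b * N.choose (b + 1)) * (X + 1) ^ b =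
      1 - (-X) ^ N := by
    have h1 : (-X : ℝ[X]) ^ N = (-(X + 1) + 1) ^ N := by congr 1; ring
    rw [h1, add_pow, sum_range_succ', mul_sum]
    simp only [one_pow, mul_one, pow_zero, Nat.choose_zero_right, Nat.cast_one]
    rw [sub_add_eq_sub_sub, sub_right_comm, sub_self, zero_sub, ← sum_neg_distrib]
    refine sum_congr rfl fun b _ => ?_
    rw [C_mul, C_pow, C_neg, C_1, neg_pow (X + 1 : ℝ[X]) (b + 1), map_natCast]
    ring
  rcases Nat.eq_zero_or_pos a with rfl | ha0
  · have h2 := congrArg (eval 0) key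
    simp only [eval_mul, eval_add, eval_X, eval_one, eval_finsetSum, eval_C, eval_pow, eval_sub,
      eval_neg] at h2
    simpa [zero_pow (show N ≠ 0 by omega)] using h2
  · obtain ⟨a, rfl⟩ := Nat.exists_eq_succ_of_ne_zero ha0.ne'
    have h2 := congrArg (fun p : ℝ[X] => ((X + 1) ^ a * p).coeff (a + 1)) key
    simp only [mul_sub, mul_one, coeff_sub] at h2
    rw [coeff_X_add_one_pow, Nat.choose_succ_self, neg_pow, ← mul_assoc, ← mul_assoc ((X + 1) ^ a) ((-1) ^ N), coeff_mul_X_pow',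
      if_neg (by omega), Nat.cast_zero, sub_zero] at h2
    rw [if_neg (by simp), ← h2, mul_sum,
      finsetSum_coeff]
    refine sum_congr rfl fun b _ => ?_
    rw [← pow_succ, mul_left_comm, ← pow_add, coeff_C_mul, coeff_X_add_one_pow]
    ring

/-- Reindexing in which the top term is lost; nilpotency supplies `hv`. -/
theorem sum_range_smul_succ {V : Type*} [AddCommGroup V] [Module ℝ V] {N : ℕ} (f : ℕ → ℝ)
    (v : ℕ → V) (hv : v N = 0) :
    ∑ a ∈ range N, f a • v (a + 1) = ∑ a ∈ range N, (if a = 0 then 0 else f (a - 1)) • v a := by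
  have h1 := sum_range_succ' (fun a => (if a = 0 then 0 else f (a - 1)) • v a) N
  have h2 := sum_range_succ (fun a => (if a = 0 then 0 else f (a - 1)) • v a) N
  simp only [hv, smul_zero, add_zero, if_true, zero_smul] at h1 h2
  rw [← h2, h1]
  simp

/-- The coefficients of the solution of the Lyapunov equation. -/
noncomputable def solutionCoeff (N a b : ℕ) : ℝ := N * (-1 / 2) ^ (a + b) * (a + b).choose a

/-- The generating function is `N / (1 + (x + y)/2)`, and this is `(2 + x + y)` times it being `2
N`. Pascal's rule proves it. -/
theorem solutionCoeff_rec (N a b : ℕ) :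
    2 * solutionCoeff N a b + (if a = 0 then 0 else solutionCoeff N (a - 1) b) +
      (if b = 0 then 0 else solutionCoeff N a (b - 1)) =
      if a = 0 then if b = 0 then 2 * (N : ℝ) else 0 else 0 := by
  rcases a with _ | a <;> rcases b with _ | b <;> simp [solutionCoeff]
  · ring
  · ring
  · have h : (a + 1 + (b + 1)).choose (a + 1) =
        (a + (b + 1)).choose a + (a + 1 + b).choose (a + 1) := by
      rw [show a + 1 + (b + 1) = (a + (b + 1)) + 1 by ring, Nat.choose_succ_succ,
        show a + (b + 1) = a + 1 + b by ring]
    rw [h, show a + 1 + (b + 1) = (a + b) + 2 by ring, show a + (b + 1) = a + b + 1 by ring,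
      show a + 1 + b = a + b + 1 by ring]
    push_cast
    ring

/-- The solution `S` of `(1 + Aᵀ) S + S (1 + A) = 2 N e eᵀ` for nilpotent `A`, where `e` is the
last basis vector. -/
noncomputable def solution {n : ℕ} (A : Matrix (Fin (n + 1)) (Fin (n + 1)) ℝ) :
    Matrix (Fin (n + 1)) (Fin (n + 1)) ℝ :=
  ∑ a ∈ range (n + 1), ∑ b ∈ range (n + 1), solutionCoeff (n + 1) a b •
    (A.transpose ^ a * Matrix.single (Fin.last n) (Fin.last n) 1 * A ^ b)

variable {n : ℕ} {A : Matrix (Fin (n + 1)) (Fin (n + 1)) ℝ}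

theorem solution_isSymm : (solution A).IsSymm := by
  rw [Matrix.IsSymm, solution, Matrix.transpose_sum, sum_comm]
  simp only [Matrix.transpose_sum, Matrix.transpose_smul, Matrix.transpose_mul,
    Matrix.transpose_pow, Matrix.transpose_transpose, Matrix.transpose_single]
  refine sum_congr rfl fun b _ => sum_congr rfl fun a _ => ?_
  rw [mul_assoc, solutionCoeff, solutionCoeff, add_comm a b,
    show (b + a).choose a = (b + a).choose b from Nat.choose_symm_add.symm]

/-- Multiplying by `Aᵀ` on the left or `A` on the right shifts `a` or `b`, so `solutionCoeff_rec`
leaves only the term `a = b = 0`. -/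
theorem solution_lyapunov (hA : A ^ (n + 1) = 0) :
    (1 + A).transpose * solution A + solution A * (1 + A) =
      Matrix.single (Fin.last n) (Fin.last n) (2 * (n + 1 : ℝ)) := by
  set E : Matrix (Fin (n + 1)) (Fin (n + 1)) ℝ := Matrix.single (Fin.last n) (Fin.last n) 1 with hE
  have hAt : A.transpose ^ (n + 1) = 0 := by rw [← Matrix.transpose_pow, hA, Matrix.transpose_zero]
  have h1 : A.transpose * solution A = ∑ a ∈ range (n + 1), ∑ b ∈ range (n + 1),
      (if a = 0 then 0 else solutionCoeff (n + 1) (a - 1) b) • (A.transpose ^ a * E * A ^ b) := by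
    rw [solution, sum_comm, mul_sum]
    conv_rhs => rw [sum_comm]
    refine sum_congr rfl fun b _ => ?_
    rw [← sum_range_smul_succ (fun a => solutionCoeff (n + 1) a b)
      (fun a => A.transpose ^ a * E * A ^ b) (by simp [hAt]), mul_sum]
    refine sum_congr rfl fun a _ => ?_
    rw [mul_smul_comm, pow_succ' A.transpose a]
    simp only [mul_assoc, E]
  have h2 : solution A * A = ∑ a ∈ range (n + 1), ∑ b ∈ range (n + 1),
      (if b = 0 then 0 else solutionCoeff (n + 1) a (b - 1)) • (A.transpose ^ a * E * A ^ b) := by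
    rw [solution, sum_mul]
    refine sum_congr rfl fun a _ => ?_
    rw [← sum_range_smul_succ (fun b => solutionCoeff (n + 1) a b)
      (fun b => A.transpose ^ a * E * A ^ b) (by simp [hA]), sum_mul]
    refine sum_congr rfl fun b _ => ?_
    rw [smul_mul_assoc, pow_succ A b]
    simp only [mul_assoc, E]
  have h3 : (1 + A).transpose * solution A + solution A * (1 + A) =
      (2 : ℝ) • solution A + A.transpose * solution A + solution A * A := by
    rw [Matrix.transpose_add, Matrix.transpose_one, two_smul]
    noncomm_ring
  have h4 : (2 : ℝ) • solution A + A.transpose * solution A + solution A * A =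
      ∑ a ∈ range (n + 1), ∑ b ∈ range (n + 1), (if a = 0 then if b = 0 then 2 * (n + 1 : ℝ) else 0
        else 0) • (A.transpose ^ a * E * A ^ b) := by
    rw [h1, h2, solution, smul_sum, ← sum_add_distrib, ← sum_add_distrib]
    refine sum_congr rfl fun a _ => ?_
    rw [smul_sum, ← sum_add_distrib, ← sum_add_distrib]
    refine sum_congr rfl fun b _ => ?_
    rw [smul_smul, ← add_smul, ← add_smul, solutionCoeff_rec, Nat.cast_succ]
  rw [h3, h4, sum_eq_single 0, sum_eq_single 0]
  · simp [hE]
  · intro b _ hb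
    simp [hb]
  · simp
  · intro a _ ha
    simp [ha]
  · simp

end Solution

end HMatrix

namespace HMatrix

open Finset

/-! ### Sums over pairs as quadratic forms. -/

section Pairs

theorem sum_sum_eq_sum_pairs {N : ℕ} (F : Fin N → Fin N → ℝ) :
    ∑ i, ∑ j, F i j = ∑ i, ∑ j, (if j < i then F i j + F j i else 0) + ∑ i, F i i := by
  have h1 : ∀ i j, F i j = (if j < i then F i j else 0) + (if i < j then F i j else 0) +
      if j = i then F i j else 0 := by
    intro i j
    rcases lt_trichotomy i j with h | rfl | h
    · simp [h, h.not_gt, h.ne']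
    · simp
    · simp [h, h.not_gt, h.ne]
  have h2 : ∑ i, ∑ j, (if i < j then F i j else 0) = ∑ i, ∑ j, if j < i then F j i else 0 :=
    sum_comm
  have h3 : ∀ i j, (if j < i then F i j + F j i else 0) =
      (if j < i then F i j else 0) + if j < i then F j i else 0 := by
    intro i j
    split_ifs <;> simp
  conv_lhs => enter [2, i, 2, j]; rw [h1 i j]
  simp only [sum_add_distrib, h2, h3]
  simp

/-- A weighted sum over pairs as the bilinear form of a Laplacian matrix. -/
theorem sum_laplacian_mul {N : ℕ} {L : Matrix (Fin N) (Fin N) ℝ} (hL : L.IsSymm)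
    (hL1 : L.mulVec 1 = 0) (f : Fin N → Fin N → ℝ) :
    ∑ i, ∑ j, L i j * f i j =
      ∑ i, ∑ j, if j < i then -L i j * (f i i - f i j - f j i + f j j) else 0 := by
  have h0 : ∀ i, ∑ j, L i j = 0 := fun i => by
    simpa [Matrix.mulVec, dotProduct] using congrFun hL1 i
  have h1 : ∑ i, ∑ j, L i j * f i j = ∑ i, ∑ j, L i j * (f i j - f i i) := by
    refine sum_congr rfl fun i _ => ?_
    simp only [mul_sub, sum_sub_distrib, ← sum_mul, h0, zero_mul, sub_zero]
  rw [h1, sum_sum_eq_sum_pairs]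
  simp only [sub_self, mul_zero, sum_const_zero, add_zero]
  refine sum_congr rfl fun i _ => sum_congr rfl fun j _ => ?_
  rw [hL.apply i j]
  split_ifs <;> ring

theorem sum_Icc_one_pred_eq {N : ℕ} (F : ℕ → ℕ → ℝ) :
    ∑ k ∈ Icc 1 N, ∑ j ∈ Icc 1 (k - 1), F k j =
      ∑ i : Fin N, ∑ j : Fin N, if j < i then F (i + 1) (j + 1) else 0 := by
  rw [sum_Icc_one_eq_sum_fin]
  refine sum_congr rfl fun i _ => ?_
  have h := sum_Icc_one_eq_sum_fin N fun l => if l ≤ (i : ℕ) then F (i + 1) l else 0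
  have h2 : (Icc 1 N).filter (fun l => l ≤ (i : ℕ)) = Icc 1 ((i : ℕ) + 1 - 1) := by
    ext l
    simp only [mem_filter, mem_Icc]
    have := i.2
    omega
  rw [← sum_filter, h2] at h
  rw [h]
  rfl

theorem sum_mul_inner_symm {N : ℕ} {E : Type*} [NormedAddCommGroup E] [InnerProductSpace ℝ E]
    (Q : Matrix (Fin N) (Fin N) ℝ) (G : Fin N → E) :
    2 * ∑ i, ∑ j, Q i j * inner ℝ (G i) (G j) =
      ∑ i, ∑ j, (Q + Q.transpose) i j * inner ℝ (G i) (G j) := by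
  simp only [Matrix.add_apply, Matrix.transpose_apply, add_mul, sum_add_distrib, two_mul]
  congr 1
  rw [sum_comm]
  simp only [real_inner_comm]

theorem add_transpose_eq_zero_of_forall {N : ℕ} {Q : Matrix (Fin N) (Fin N) ℝ}
    (hQ : ∀ t : Fin N → ℝ, t ⬝ᵥ Q.mulVec t = 0) : Q + Q.transpose = 0 := by
  ext i j
  have h1 := hQ (Pi.single i 1)
  have h2 := hQ (Pi.single j 1)
  have h3 := hQ (Pi.single i 1 + Pi.single j 1)
  simp only [Matrix.mulVec_add, dotProduct_add, add_dotProduct, Matrix.mulVec_single_one,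
    single_one_dotProduct, Matrix.col_apply] at h1 h2 h3
  simp only [Matrix.add_apply, Matrix.transpose_apply, Matrix.zero_apply]
  linarith

end Pairs

/-! ### Existence and uniqueness of the H-certificates. -/

section Certificate

theorem sum_formalX_pairs {N : ℕ} (H : Matrix (Fin (N - 1)) (Fin (N - 1)) ℝ)
    {L : Matrix (Fin N) (Fin N) ℝ} (hL : L.IsSymm) (hL1 : L.mulVec 1 = 0) {lam : ℕ → ℕ → ℝ}
    (hlam : ∀ i j : Fin N, j < i → lam (i + 1) (j + 1) = -L i j)
    {E : Type*} [NormedAddCommGroup E] [InnerProductSpace ℝ E] (y₀ : E) (g : ℕ → E) :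
    ∑ k ∈ Icc 1 N, ∑ j ∈ Icc 1 (k - 1),
        lam k j * inner ℝ (formalX H y₀ g k - formalX H y₀ g j) (g k - g j) =
      -∑ i : Fin N, ∑ j : Fin N,
        ((1 + stepMatrix H).transpose * L) i j * inner ℝ (g (i + 1)) (g (j + 1)) := by
  set M := 1 + stepMatrix H with hM
  -- This is `⟪x_i, g_j⟫` without its `y₀` part, which cancels in the differences.
  let f : Fin N → Fin N → ℝ := fun i j => -inner ℝ (∑ k : Fin N, M i k • g (k + 1)) (g (j + 1))
  have h1 : ∑ i, ∑ j, L i j * f i j = -∑ i : Fin N, ∑ j : Fin N,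
        (M.transpose * L) i j * inner ℝ (g (i + 1)) (g (j + 1)) := by
    simp only [f, sum_inner, real_inner_smul_left, mul_neg, sum_neg_distrib, mul_sum,
      Matrix.mul_apply, Matrix.transpose_apply, sum_mul]
    congr 1
    calc _ = ∑ i : Fin N, ∑ k : Fin N, ∑ j : Fin N,
          L i j * (M i k * inner ℝ (g (k + 1)) (g (j + 1))) :=
          sum_congr rfl fun i _ => sum_comm
      _ = ∑ k : Fin N, ∑ i : Fin N, ∑ j : Fin N,
          L i j * (M i k * inner ℝ (g (k + 1)) (g (j + 1))) := sum_comm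
      _ = _ := by
        refine sum_congr rfl fun k _ => ?_
        rw [sum_comm]
        refine sum_congr rfl fun j _ => sum_congr rfl fun i _ => by ring
  rw [← h1, sum_laplacian_mul hL hL1, sum_Icc_one_pred_eq]
  refine sum_congr rfl fun i _ => sum_congr rfl fun j _ => ?_
  by_cases hij : j < i
  · rw [if_pos hij, if_pos hij, hlam i j hij, formalX_eq, formalX_eq, sub_sub_sub_cancel_left]
    simp only [f, inner_sub_left, inner_sub_right, ← hM]
    ring
  · rw [if_neg hij, if_neg hij]

variable {n : ℕ} {H : Matrix (Fin (n + 1 - 1)) (Fin (n + 1 - 1)) ℝ}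

theorem Invariance.P_eq (hH : Invariance (n + 1) H) {m : ℕ} (hm : m ≤ n) :
    (n + 1 : ℝ) * P H n m = (n + 1).choose (m + 1) := by
  have hn : (n + 1 : ℝ) ≠ 0 := by positivity
  rcases Nat.eq_zero_or_pos m with rfl | hm0
  · simp
  · have := hH m hm0 hm
    rw [add_tsub_cancel_right] at this
    rw [this]
    push_cast
    field_simp

/-- This makes `S - E` have zero row sums. Invariance turns the coefficient of `(Aᵀ)^a e` into
`(-1/2)^a` times the alternating binomial sum evaluated above. -/
theorem solution_mulVec_one (hH : Invariance (n + 1) H) :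
    (solution (stepMatrix H)).mulVec 1 = Pi.single (Fin.last n) 1 := by
  set A := stepMatrix H with hA
  have h1 : ∀ a b, (A.transpose ^ a * Matrix.single (Fin.last n) (Fin.last n) (1 : ℝ) *
      A ^ b).mulVec 1 =
      (2 ^ b * P H n b) • (A.transpose ^ a).mulVec (Pi.single (Fin.last n) 1) := by
    intro a b
    rw [← Matrix.mulVec_mulVec, ← Matrix.mulVec_mulVec, ← Matrix.mulVec_smul]
    congr 1
    ext i
    have h := stepMatrix_pow_mulVec_one H b (Fin.last n)
    rw [Fin.val_last, ← hA] at h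
    rw [Matrix.single_mulVec, one_mul, h]
    by_cases hi : i = Fin.last n
    · subst hi; simp
    · simp [hi]
  have h2 : ∀ a ∈ range (n + 1), ∑ b ∈ range (n + 1),
      solutionCoeff (n + 1) a b * (2 ^ b * P H n b) = if a = 0 then 1 else 0 := by
    intro a ha
    have h3 := sum_neg_one_pow_mul_choose_mul_choose (mem_range.1 ha)
    have h4 : ∑ b ∈ range (n + 1), solutionCoeff (n + 1) a b * (2 ^ b * P H n b) =
        (-1 / 2) ^ a * ∑ b ∈ range (n + 1),
          (-1 : ℝ) ^ b * (a + b).choose a * (n + 1).choose (b + 1) := by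
      rw [mul_sum]
      refine sum_congr rfl fun b hb => ?_
      rw [← hH.P_eq (Nat.lt_succ_iff.1 (mem_range.1 hb)), solutionCoeff, pow_add]
      have : (-1 / 2 : ℝ) ^ b * 2 ^ b = (-1) ^ b := by rw [← mul_pow]; norm_num
      rw [← this]
      push_cast
      ring
    rw [h4, h3]
    split_ifs with h <;> simp [h]
  rw [solution, Matrix.sum_mulVec]
  simp only [Matrix.sum_mulVec, Matrix.smul_mulVec, h1, smul_smul, ← sum_smul]
  rw [sum_congr rfl fun a ha => by rw [h2 a ha], sum_eq_single 0]
  · rw [if_pos rfl, one_smul, pow_zero, Matrix.one_mulVec]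
  · intro a _ ha
    simp [ha]
  · simp

theorem exists_isCertificate (hH : Invariance (n + 1) H) :
    ∃ lam : ℕ → ℕ → ℝ, IsCertificate (n + 1) H lam := by
  set M := 1 + stepMatrix H with hM
  set S := solution (stepMatrix H) with hS
  set E : Matrix (Fin (n + 1)) (Fin (n + 1)) ℝ := Matrix.single (Fin.last n) (Fin.last n) 1 with hE
  have hLs : (S - E).IsSymm := by
    rw [Matrix.IsSymm, Matrix.transpose_sub, solution_isSymm, hE, Matrix.transpose_single]
  have hL1 : (S - E).mulVec 1 = 0 := by
    rw [Matrix.sub_mulVec, solution_mulVec_one hH, hE]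
    ext i
    rw [Pi.sub_apply, Matrix.single_mulVec]
    by_cases hi : i = Fin.last n
    · subst hi; simp
    · simp [hi]
  -- The multipliers are the negated off-diagonal entries of `S - E`, and `E` is diagonal; indices
  -- shift by one.
  refine ⟨fun k j => if h : k - 1 < n + 1 ∧ j - 1 < n + 1 then -S ⟨k - 1, h.1⟩ ⟨j - 1, h.2⟩ else 0,
    fun d y₀ g => ?_⟩
  rw [sum_formalX_pairs H hLs hL1]
  swap
  · intro i j hij
    have h0 : E i j = 0 := by
      rw [hE, Matrix.single_apply, if_neg]
      rintro ⟨rfl, rfl⟩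
      exact lt_irrefl _ hij
    simp only [add_tsub_cancel_right, Matrix.sub_apply, h0, sub_zero]
    rw [dif_pos ⟨i.2, j.2⟩]
  have h1 : ∑ i : Fin (n + 1), ∑ j : Fin (n + 1),
      (M.transpose * S) i j * inner ℝ (g (i + 1)) (g (j + 1)) = (n + 1) * ‖g (n + 1)‖ ^ 2 := by
    have h2 := sum_mul_inner_symm (M.transpose * S) fun i : Fin (n + 1) => g (i + 1)
    have h3 : (M.transpose * S).transpose = S * M := by
      rw [Matrix.transpose_mul, Matrix.transpose_transpose, solution_isSymm]
    rw [h3, solution_lyapunov (stepMatrix_pow_eq_zero H)] at h2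
    have h6 : ∑ i : Fin (n + 1), ∑ j : Fin (n + 1),
        Matrix.single (Fin.last n) (Fin.last n) (2 * (n + 1 : ℝ)) i j *
          inner ℝ (g (i + 1)) (g (j + 1)) = 2 * (n + 1) * ‖g (n + 1)‖ ^ 2 := by
      rw [sum_eq_single (Fin.last n), sum_eq_single (Fin.last n)]
      · rw [Matrix.single_apply_same, real_inner_self_eq_norm_sq, Fin.val_last]
      · intro j _ hj
        rw [Matrix.single_apply_of_col_ne _ _ hj.symm, zero_mul]
      · simp
      · intro i _ hi
        refine sum_eq_zero fun j _ => ?_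
        rw [Matrix.single_apply_of_row_ne hi.symm, zero_mul]
      · simp
    rw [h6] at h2
    linarith
  have h4 : ∑ i : Fin (n + 1), ∑ j : Fin (n + 1),
      (M.transpose * E) i j * inner ℝ (g (i + 1)) (g (j + 1)) =
      inner ℝ (∑ i : Fin (n + 1), M (Fin.last n) i • g (i + 1)) (g (n + 1)) := by
    rw [sum_inner]
    refine sum_congr rfl fun i _ => ?_
    rw [sum_eq_single (Fin.last n)]
    · rw [hE, Matrix.mul_single_apply_same, real_inner_smul_left]
      simp
    · intro j _ hj
      rw [hE, Matrix.mul_single_apply_of_ne _ _ _ _ _ hj, zero_mul]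
    · simp
  have h5 := formalX_eq H y₀ g (Fin.last n)
  rw [Fin.val_last, ← hM] at h5
  rw [h5, sub_sub_cancel_left, inner_neg_right, real_inner_comm, ← h4, ← hM, Matrix.mul_sub]
  simp only [Matrix.sub_apply, sub_mul, sum_sub_distrib, h1]
  push_cast
  ring

/-- The difference of two certificates gives a Laplacian `L` with `Mᵀ L + L M = 0`, hence `L = 0`.
No invariance is needed. -/
theorem IsCertificate.unique {N : ℕ} {H : Matrix (Fin (N - 1)) (Fin (N - 1)) ℝ}
    {lam lam' : ℕ → ℕ → ℝ} (h : IsCertificate N H lam) (h' : IsCertificate N H lam')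
    (i j : Fin N) (hij : j < i) : lam (i + 1) (j + 1) = lam' (i + 1) (j + 1) := by
  set μ : ℕ → ℕ → ℝ := fun k j => lam k j - lam' k j with hμ
  let W : Matrix (Fin N) (Fin N) ℝ := Matrix.of fun i j =>
    if j < i then -μ (i + 1) (j + 1) else if i < j then -μ (j + 1) (i + 1) else 0
  let L : Matrix (Fin N) (Fin N) ℝ := W - Matrix.diagonal (W.mulVec 1)
  have hW : W.IsSymm := by
    ext i j
    simp only [W, Matrix.transpose_apply, Matrix.of_apply]
    rcases lt_trichotomy i j with h | rfl | h
    · simp [h, h.not_gt]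
    · simp
    · simp [h, h.not_gt]
  have hLs : L.IsSymm := by
    rw [Matrix.IsSymm, Matrix.transpose_sub, hW, Matrix.diagonal_transpose]
  have hL1 : L.mulVec 1 = 0 := by
    ext i
    simp [L, Matrix.sub_mulVec, Matrix.mulVec_diagonal]
  have hLμ : ∀ i j : Fin N, j < i → μ (i + 1) (j + 1) = -L i j := by
    intro i j hij
    simp [L, W, hij, Matrix.diagonal_apply_ne _ hij.ne']
  have hQ : ∀ t : Fin N → ℝ, t ⬝ᵥ ((1 + stepMatrix H).transpose * L).mulVec t = 0 := by
    intro t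
    -- Scalar vectors already test the quadratic form at every `t`.
    let g : ℕ → EuclideanSpace ℝ (Fin 1) := fun k =>
      EuclideanSpace.single 0 (if hk : k - 1 < N then t ⟨k - 1, hk⟩ else 0)
    have h1 := h 1 0 g
    have h2 := h' 1 0 g
    have h3 := sum_formalX_pairs H hLs hL1 hLμ 0 g
    simp only [hμ, sub_mul, sum_sub_distrib] at h3
    have h4 : ∀ i j : Fin N, inner ℝ (g (i + 1)) (g (j + 1)) = t i * t j := by
      intro i j
      simp [g, EuclideanSpace.inner_single_left]
    simp only [h4] at h3
    have h5 : t ⬝ᵥ ((1 + stepMatrix H).transpose * L).mulVec t = ∑ i, ∑ j,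
        ((1 + stepMatrix H).transpose * L) i j * (t i * t j) := by
      simp only [dotProduct, Matrix.mulVec, mul_sum]
      refine sum_congr rfl fun i _ => sum_congr rfl fun j _ => by ring
    linarith
  have h1 := add_transpose_eq_zero_of_forall hQ
  rw [Matrix.transpose_mul, Matrix.transpose_transpose, hLs, Matrix.transpose_add,
    Matrix.transpose_one] at h1
  have hnil : IsNilpotent (stepMatrix H) := ⟨N, stepMatrix_pow_eq_zero H⟩
  have hnil' : IsNilpotent (stepMatrix H).transpose :=
    ⟨N, by rw [← Matrix.transpose_pow, stepMatrix_pow_eq_zero, Matrix.transpose_zero]⟩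
  have h2 := hLμ i j hij
  rw [eq_zero_of_lyapunov hnil' hnil h1, Matrix.zero_apply, neg_zero] at h2
  exact sub_eq_zero.1 h2

theorem isCertificate_certificate (hH : Invariance (n + 1) H) :
    IsCertificate (n + 1) H (certificate (n + 1) H) := by
  rw [certificate, dif_pos (exists_isCertificate hH)]
  exact (exists_isCertificate hH).choose_spec

end Certificate

end HMatrix

namespace HMatrix

open Finset Topology

/-! ### From certificates to rates, and from rates to inequalities on vectors. -/

section Rate

variable {N : ℕ} {H : Matrix (Fin (N - 1)) (Fin (N - 1)) ℝ}
  {E : Type*} [NormedAddCommGroup E] [InnerProductSpace ℝ E]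

theorem formalY_succ (y₀ : E) (g : ℕ → E) (k : ℕ) :
    formalY H y₀ g (k + 1) =
      formalY H y₀ g k - ∑ j ∈ Icc 1 (k + 1), (2 * entry H (k + 1) j) • g j := by
  rw [formalY, sum_Icc_succ_top (by omega), formalY, sub_sub]

theorem iter_eq_formalY (T : E → E) (y₀ : E) (g : ℕ → E) (K : ℕ)
    (hg : ∀ k < K, formalY H y₀ g k - T (formalY H y₀ g k) = (2 : ℝ) • g (k + 1)) :
    ∀ k ≤ K, iter H T y₀ k = formalY H y₀ g k := by
  intro k
  induction k using Nat.strong_induction_on with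
  | _ k ih =>
    intro hk
    rcases k with _ | k
    · rw [iter]
      simp [formalY]
    · rw [iter, formalY_succ, ih k (by omega) (by omega), sum_Icc_one_eq_sum_fin]
      congr 1
      refine sum_congr rfl fun j _ => ?_
      have hj := j.2
      rw [ih j (by omega) (by omega), hg j (by omega), smul_smul, mul_comm]

/-- Translates nonexpansiveness into monotonicity of the pairs `(x_k, g_k)`. -/
theorem inner_half_add_half_sub (u v : E) :
    inner ℝ ((1 / 2 : ℝ) • (u + v)) ((1 / 2 : ℝ) • (u - v)) = (‖u‖ ^ 2 - ‖v‖ ^ 2) / 4 := by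
  rw [real_inner_smul_left, real_inner_smul_right, inner_add_left, inner_sub_right,
    inner_sub_right, real_inner_self_eq_norm_sq, real_inner_self_eq_norm_sq, real_inner_comm v u]
  ring

theorem hasOptimalRate_of_isCertificate {d : ℕ} (hN : 1 ≤ N) {lam : ℕ → ℕ → ℝ}
    (hlam : IsCertificate N H lam)
    (hnonneg : ∀ k j : ℕ, 2 ≤ k → k ≤ N → 1 ≤ j → j ≤ k - 1 → 0 ≤ lam k j) :
    HasOptimalRate N d H := by
  intro T hT y₀ yStar hy
  set g : ℕ → EuclideanSpace ℝ (Fin d) := fun k =>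
    (1 / 2 : ℝ) • (iter H T y₀ (k - 1) - T (iter H T y₀ (k - 1))) with hg
  have hY : ∀ k, iter H T y₀ k = formalY H y₀ g k := by
    intro k
    induction k using Nat.strong_induction_on with
    | _ k ih =>
      refine iter_eq_formalY T y₀ g k (fun j hj => ?_) k le_rfl
      rw [← ih j hj, hg]
      simp
  have hX : ∀ k, formalX H y₀ g k =
      (1 / 2 : ℝ) • (iter H T y₀ (k - 1) + T (iter H T y₀ (k - 1))) := by
    intro k
    rw [formalX, ← hY, hg]
    module
  have hslack : ∀ k j, 0 ≤ inner ℝ (formalX H y₀ g k - formalX H y₀ g j) (g k - g j) := by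
    intro k j
    rw [hX, hX, hg]
    simp only [← smul_sub]
    rw [add_sub_add_comm, sub_sub_sub_comm, inner_half_add_half_sub]
    have := pow_le_pow_left₀ (norm_nonneg _) (hT (iter H T y₀ (k - 1)) (iter H T y₀ (j - 1))) 2
    linarith
  have hstar : 0 ≤ inner ℝ (formalX H y₀ g N - yStar) (g N) := by
    have e1 : formalX H y₀ g N - yStar = (1 / 2 : ℝ) • ((iter H T y₀ (N - 1) - yStar) +
        (T (iter H T y₀ (N - 1)) - T yStar)) := by
      rw [hX, hy]
      module
    have e2 : g N = (1 / 2 : ℝ) • ((iter H T y₀ (N - 1) - yStar) -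
        (T (iter H T y₀ (N - 1)) - T yStar)) := by
      rw [hg, hy]
      module
    rw [e1, e2, inner_half_add_half_sub]
    have := pow_le_pow_left₀ (norm_nonneg _) (hT (iter H T y₀ (N - 1)) yStar) 2
    linarith
  have hsum : 0 ≤ ∑ k ∈ Icc 1 N, ∑ j ∈ Icc 1 (k - 1),
      lam k j * inner ℝ (formalX H y₀ g k - formalX H y₀ g j) (g k - g j) := by
    refine sum_nonneg fun k hk => sum_nonneg fun j hj => mul_nonneg ?_ (hslack k j)
    rw [mem_Icc] at hk hj
    exact hnonneg k j (by omega) hk.2 hj.1 hj.2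
  have hid := hlam d y₀ g
  have hle : (N : ℝ) * ‖g N‖ ^ 2 ≤ ‖g N‖ * ‖y₀ - yStar‖ := by
    have e1 : inner ℝ (g N) (y₀ - yStar) =
        inner ℝ (formalX H y₀ g N - yStar) (g N) - inner ℝ (g N) (formalX H y₀ g N - y₀) := by
      rw [real_inner_comm (g N) (formalX H y₀ g N - yStar), ← inner_sub_right]
      congr 1
      abel
    have := real_inner_le_norm (g N) (y₀ - yStar)
    linarith
  have hle' : N * ‖g N‖ ≤ ‖y₀ - yStar‖ := by
    rcases (norm_nonneg (g N)).eq_or_lt with h0 | h0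
    · rw [← h0, mul_zero]
      exact norm_nonneg _
    · refine le_of_mul_le_mul_left ?_ h0
      linarith
  have hres : iter H T y₀ (N - 1) - T (iter H T y₀ (N - 1)) = (2 : ℝ) • g N := by
    rw [hg]
    module
  have hNpos : (0 : ℝ) < N := by exact_mod_cast hN
  rw [hres, norm_smul, le_div_iff₀ (by positivity)]
  have := pow_le_pow_left₀ (by positivity) hle' 2
  norm_num
  linarith

/-- Finitely many vectors satisfying the interpolation inequalities for monotone operators are
realized by a nonexpansive operator with fixed point `0`. -/
theorem HasOptimalRate.norm_le {d : ℕ} (hN : 1 ≤ N) (h : HasOptimalRate N d H)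
    (y₀ : EuclideanSpace ℝ (Fin d)) (g : ℕ → EuclideanSpace ℝ (Fin d))
    (h1 : ∀ i j : Fin N, 0 ≤ inner ℝ (formalX H y₀ g (i + 1) - formalX H y₀ g (j + 1))
      (g (i + 1) - g (j + 1)))
    (h2 : ∀ i : Fin N, 0 ≤ inner ℝ (formalX H y₀ g (i + 1)) (g (i + 1))) :
    (N : ℝ) ^ 2 * ‖g N‖ ^ 2 ≤ ‖y₀‖ ^ 2 := by
  have key : ∀ x y : EuclideanSpace ℝ (Fin d), 0 ≤ inner ℝ x y → ‖x - y‖ ≤ ‖x + y‖ := by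
    intro x y hxy
    refine le_of_sq_le_sq ?_ (norm_nonneg _)
    rw [norm_sub_sq_real, norm_add_sq_real]
    linarith
  -- `none` stands for the fixed point `0`; otherwise `x + g` is an iterate and `x - g` its
  -- prescribed image.
  let a : Option (Fin N) → EuclideanSpace ℝ (Fin d) := fun i =>
    i.elim 0 fun i => formalX H y₀ g (i + 1) + g (i + 1)
  let b : Option (Fin N) → EuclideanSpace ℝ (Fin d) := fun i =>
    i.elim 0 fun i => formalX H y₀ g (i + 1) - g (i + 1)
  obtain ⟨T, hT, hTab⟩ := exists_nonexpansive_extension a b (by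
    rintro (_ | i) (_ | j)
    · simp [a, b]
    · simp only [a, b, Option.elim, zero_sub, norm_neg]
      exact key _ _ (h2 j)
    · simpa [a, b] using key _ _ (h2 i)
    · simp only [a, b, Option.elim]
      rw [sub_sub_sub_comm, add_sub_add_comm]
      exact key _ _ (h1 i j))
  have hfix : T 0 = 0 := hTab none
  have hY : ∀ k < N, formalY H y₀ g k - T (formalY H y₀ g k) = (2 : ℝ) • g (k + 1) := by
    intro k hk
    have e1 := hTab (some ⟨k, hk⟩)
    have e2 : a (some ⟨k, hk⟩) = formalY H y₀ g k := by simp [a, formalX]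
    rw [e2] at e1
    rw [e1]
    simp only [b, formalX, Option.elim, add_tsub_cancel_right]
    module
  have hr := h T hT y₀ 0 hfix
  rw [iter_eq_formalY T y₀ g N hY (N - 1) (by omega), hY (N - 1) (by omega),
    Nat.sub_add_cancel hN, norm_smul, sub_zero] at hr
  have hNpos : (0 : ℝ) < N := by exact_mod_cast hN
  rw [le_div_iff₀ (by positivity)] at hr
  norm_num at hr
  linarith

theorem formalX_add_smul (y₀ y₁ : E) (g γ : ℕ → E) (ε : ℝ) (k : ℕ) :
    formalX H (y₀ + ε • y₁) (fun k => g k + ε • γ k) k =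
      formalX H y₀ g k + ε • formalX H y₁ γ k := by
  simp only [formalX, formalY, smul_add, sum_add_distrib, smul_sub, smul_sum]
  simp only [smul_comm ε]
  abel

theorem formalX_add (y₀ u : E) (g : ℕ → E) (k : ℕ) :
    formalX H (y₀ + u) g k = formalX H y₀ g k + u := by
  simp only [formalX, formalY]
  abel

end Rate

/-! ### Perturbing a tight example: nonnegativity of the certificates. -/

section Perturbation

theorem exists_inner_eq {ι E : Type*} [NormedAddCommGroup E] [InnerProductSpace ℝ E]
    [FiniteDimensional ℝ E] {w : ι → E} (hw : LinearIndependent ℝ w) (r : ι → ℝ) :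
    ∃ u : E, ∀ i, inner ℝ (w i) u = r i := by
  obtain ⟨f, hf⟩ := LinearMap.exists_extend ((Module.Basis.span hw).constr ℝ r)
  refine ⟨(InnerProductSpace.toDual ℝ E).symm (LinearMap.toContinuousLinearMap f), fun i => ?_⟩
  rw [real_inner_comm, InnerProductSpace.toDual_symm_apply, LinearMap.coe_toContinuousLinearMap']
  have h1 := DFunLike.congr_fun hf (Module.Basis.span hw i)
  rwa [LinearMap.comp_apply, Module.Basis.constr_basis, Submodule.subtype_apply,
    Module.Basis.span_apply] at h1

theorem eventually_pos_mul_add_sq_mul {a : ℝ} (ha : 0 < a) (b : ℝ) :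
    ∀ᶠ ε in 𝓝[>] (0 : ℝ), 0 < ε * a + ε ^ 2 * b := by
  have h1 : Continuous fun ε : ℝ => a + ε * b := by fun_prop
  have h2 : ∀ᶠ ε in 𝓝 (0 : ℝ), 0 < a + ε * b :=
    (h1.tendsto 0).eventually (lt_mem_nhds (by simpa using ha))
  filter_upwards [nhdsWithin_le_nhds h2, self_mem_nhdsWithin] with ε h3 h4
  have := mul_pos h4 h3
  linarith

theorem inner_add_smul_add_smul {E : Type*} [NormedAddCommGroup E] [InnerProductSpace ℝ E]
    (x ξ g γ : E) (ε : ℝ) : inner ℝ (x + ε • ξ) (g + ε • γ) =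
      inner ℝ x g + ε * (inner ℝ x γ + inner ℝ ξ g) + ε ^ 2 * inner ℝ ξ γ := by
  simp only [inner_add_left, inner_add_right, real_inner_smul_left, real_inner_smul_right]
  ring

variable {N : ℕ} {H : Matrix (Fin (N - 1)) (Fin (N - 1)) ℝ}
  {E : Type*} [NormedAddCommGroup E] [InnerProductSpace ℝ E] [FiniteDimensional ℝ E]

/-- Near linearly independent `g_1, …, g_N`, the first-order changes of the slacks can be
prescribed. -/
theorem exists_direction {y₀ : E} {g : ℕ → E}
    (hg : LinearIndependent ℝ fun i : Fin N => g (i + 1)) {Q : Matrix (Fin N) (Fin N) ℝ}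
    (hQ : Q.IsSymm) (hQ0 : ∀ i, Q i i = 0) :
    ∃ (γ : ℕ → E) (u : E),
      (∀ i j : Fin N,
        inner ℝ (formalX H y₀ g (i + 1) - formalX H y₀ g (j + 1)) (γ (i + 1) - γ (j + 1)) +
        inner ℝ (formalX H ((N : ℝ) • γ N + u) γ (i + 1) -
          formalX H ((N : ℝ) • γ N + u) γ (j + 1)) (g (i + 1) - g (j + 1)) = Q i j) ∧
      ∀ i : Fin N, inner ℝ (formalX H y₀ g (i + 1)) (γ (i + 1)) +
        inner ℝ (formalX H ((N : ℝ) • γ N + u) γ (i + 1)) (g (i + 1)) = 1 := by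
  -- `D i j` plays the role of `2 ⟪g_i, γ_j⟫`. As `Q` has zero diagonal, the first-order slack
  -- changes are then exactly the entries of `M D + D Mᵀ`.
  obtain ⟨D, hD, hDQ⟩ := exists_isSymm_lyapunov (A := stepMatrix H)
    ⟨N, stepMatrix_pow_eq_zero H⟩ hQ
  set M := 1 + stepMatrix H with hM
  choose γ' hγ' using fun j : Fin N => exists_inner_eq hg fun i => D i j / 2
  let γ : ℕ → E := fun k => if hk : k - 1 < N then γ' ⟨k - 1, hk⟩ else 0
  have hγ : ∀ i j : Fin N, inner ℝ (g (i + 1)) (γ (j + 1)) = D i j / 2 := by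
    intro i j
    simp only [γ, add_tsub_cancel_right, j.2, dif_pos]
    exact hγ' j i
  -- Translating every `x_i` by `u` leaves the pair slacks unchanged, so `u` is free to fix the
  -- slacks against the fixed point.
  obtain ⟨u, hu⟩ := exists_inner_eq hg fun i => 1 - inner ℝ (formalX H y₀ g (i + 1)) (γ (i + 1)) -
    inner ℝ (formalX H ((N : ℝ) • γ N) γ (i + 1)) (g (i + 1))
  refine ⟨γ, u, fun i j => ?_, fun i => ?_⟩
  · have hb : ∀ i j : Fin N, inner ℝ (∑ k : Fin N, M i k • g (k + 1)) (γ (j + 1)) +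
        inner ℝ (∑ k : Fin N, M i k • γ (k + 1)) (g (j + 1)) = (M * D) i j := by
      intro i j
      simp only [sum_inner, real_inner_smul_left, Matrix.mul_apply, ← sum_add_distrib]
      refine sum_congr rfl fun k _ => ?_
      rw [hγ, real_inner_comm, hγ, hD.apply j k]
      ring
    have hs : ∀ i j, (M * D) i j + (M * D) j i = Q i j := by
      intro i j
      have h1 : (M * D).transpose = D * M.transpose := by rw [Matrix.transpose_mul, hD]
      rw [← hDQ, ← h1]
      rfl
    have h1 := hs i i
    have h2 := hs j j
    have h3 := hs i j
    rw [hQ0] at h1 h2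
    rw [← hb] at h1 h2
    rw [← hb, ← hb] at h3
    simp only [formalX_eq, sub_sub_sub_cancel_left, ← hM]
    simp only [inner_sub_left, inner_sub_right]
    linarith
  · have h1 := hu i
    rw [formalX_add, inner_add_left, real_inner_comm (g (i + 1)) u, h1]
    ring

/-- At a tight configuration with all slacks zero, a negative multiplier is exploited by opening its
slack much more than the others. Since `y - N g_N = ε u` is maintained, (*) computes `⟪g_N, u⟫` and
hence the sign of `‖y‖² - N² ‖g_N‖²` to first order. -/
theorem HasOptimalRate.certificate_nonneg {d : ℕ} (hN : 1 ≤ N) (h : HasOptimalRate N d H)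
    {lam : ℕ → ℕ → ℝ} (hlam : IsCertificate N H lam)
    {y₀ : EuclideanSpace ℝ (Fin d)} {g : ℕ → EuclideanSpace ℝ (Fin d)}
    (hg : LinearIndependent ℝ fun i : Fin N => g (i + 1)) (hy : y₀ = (N : ℝ) • g N)
    (h1 : ∀ i j : Fin N, inner ℝ (formalX H y₀ g (i + 1) - formalX H y₀ g (j + 1))
      (g (i + 1) - g (j + 1)) = 0)
    (h2 : ∀ i : Fin N, inner ℝ (formalX H y₀ g (i + 1)) (g (i + 1)) = 0)
    {a b : Fin N} (hab : b < a) : 0 ≤ lam (a + 1) (b + 1) := by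
  by_contra! hneg
  have hNpos : (0 : ℝ) < N := by exact_mod_cast hN
  set l : Fin N → Fin N → ℝ := fun i j => if j < i then lam (i + 1) (j + 1) else 0 with hl
  -- The extra weight `c` on the pair `(a, b)` outweighs the unit slacks of all other pairs and of
  -- the fixed point.
  obtain ⟨c, hc, hcneg⟩ : ∃ c : ℝ, 0 < c ∧ 1 + ∑ i, ∑ j, l i j + c * lam (a + 1) (b + 1) < 0 := by
    have h3 : ∀ᶠ c : ℝ in Filter.atTop, c * lam (a + 1) (b + 1) < -(1 + ∑ i, ∑ j, l i j) :=
      (Filter.tendsto_id.atTop_mul_const_of_neg hneg).eventually_lt_atBot _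
    obtain ⟨c, hc1, hc2⟩ := (h3.and (Filter.eventually_gt_atTop 0)).exists
    exact ⟨c, hc2, by linarith⟩
  let Q : Matrix (Fin N) (Fin N) ℝ := Matrix.of fun i j =>
    if i = j then 0 else 1 + if (i = a ∧ j = b) ∨ (i = b ∧ j = a) then c else 0
  have hQ : Q.IsSymm := by
    ext i j
    simp only [Q, Matrix.transpose_apply, Matrix.of_apply, eq_comm (a := j) (b := i)]
    congr 3
    exact propext (by tauto)
  have hQpos : ∀ i j, i ≠ j → 0 < Q i j := by
    intro i j hij
    simp only [Q, Matrix.of_apply, if_neg hij]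
    split_ifs <;> linarith
  have hQsum : 1 + ∑ i, ∑ j, l i j * Q i j < 0 := by
    have e1 : ∀ i j, l i j * Q i j =
        l i j + if i = a ∧ j = b then c * lam (a + 1) (b + 1) else 0 := by
      intro i j
      by_cases hij : j < i
      · have e2 : ¬(i = b ∧ j = a) := by
          rintro ⟨rfl, rfl⟩
          exact lt_asymm hij hab
        simp only [hl, Q, Matrix.of_apply, if_pos hij, if_neg hij.ne', e2, or_false]
        split_ifs with h3
        · rw [h3.1, h3.2]
          ring
        · ring
      · have e2 : ¬(i = a ∧ j = b) := by
          rintro ⟨rfl, rfl⟩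
          exact hij hab
        simp [hl, hij, e2]
    have e3 : ∑ i, ∑ j, (if i = a ∧ j = b then c * lam (a + 1) (b + 1) else 0) =
        c * lam (a + 1) (b + 1) := by
      simp [ite_and]
    simp only [e1, sum_add_distrib, e3]
    linarith
  obtain ⟨γ, u, hγ1, hγ2⟩ := exists_direction (H := H) (y₀ := y₀) hg hQ fun i => by simp [Q]
  set y₁ := (N : ℝ) • γ N + u with hy₁
  let q : Fin N → Fin N → ℝ := fun i j =>
    inner ℝ (formalX H y₁ γ (i + 1) - formalX H y₁ γ (j + 1)) (γ (i + 1) - γ (j + 1))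
  let last : Fin N := ⟨N - 1, by omega⟩
  have hlast : (last : ℕ) + 1 = N := Nat.sub_add_cancel hN
  let κ : ℝ := inner ℝ (formalX H y₁ γ N) (γ N) + ∑ i, ∑ j, l i j * q i j
  -- Positive slacks make the perturbed data interpolable, while the third inequality contradicts
  -- the rate; each holds to first order in `ε`.
  have hev : ∀ᶠ ε in 𝓝[>] (0 : ℝ), (∀ i j : Fin N, i ≠ j → 0 < ε * Q i j + ε ^ 2 * q i j) ∧
      (∀ i : Fin N, 0 < ε * 1 + ε ^ 2 * inner ℝ (formalX H y₁ γ (i + 1)) (γ (i + 1))) ∧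
      0 < ε * (2 * N * -(1 + ∑ i, ∑ j, l i j * Q i j)) + ε ^ 2 * -(2 * N * κ + ‖u‖ ^ 2) := by
    refine Filter.Eventually.and ?_ (Filter.Eventually.and ?_ ?_)
    · refine Filter.eventually_all.2 fun i => Filter.eventually_all.2 fun j => ?_
      by_cases hij : i = j
      · simp [hij]
      · filter_upwards [eventually_pos_mul_add_sq_mul (hQpos i j hij) (q i j)] with ε hε _ using hε
    · exact Filter.eventually_all.2 fun i => eventually_pos_mul_add_sq_mul one_pos _
    · exact eventually_pos_mul_add_sq_mul (mul_pos (by positivity) (by linarith)) _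
  obtain ⟨ε, hε1, hε2, hε3⟩ := hev.exists
  set y := y₀ + ε • y₁ with hyε
  set gε : ℕ → EuclideanSpace ℝ (Fin d) := fun k => g k + ε • γ k with hgε
  have hX : ∀ k, formalX H y gε k = formalX H y₀ g k + ε • formalX H y₁ γ k := fun k =>
    formalX_add_smul y₀ y₁ g γ ε k
  have hslack : ∀ i j : Fin N, inner ℝ (formalX H y gε (i + 1) - formalX H y gε (j + 1))
      (gε (i + 1) - gε (j + 1)) = ε * Q i j + ε ^ 2 * q i j := by
    intro i j
    rw [hX, hX, hgε]
    simp only [add_sub_add_comm, ← smul_sub]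
    rw [inner_add_smul_add_smul, h1, hγ1, zero_add]
  have hstar : ∀ i : Fin N, inner ℝ (formalX H y gε (i + 1)) (gε (i + 1)) =
      ε * 1 + ε ^ 2 * inner ℝ (formalX H y₁ γ (i + 1)) (γ (i + 1)) := by
    intro i
    rw [hX, hgε, inner_add_smul_add_smul, h2, hγ2, zero_add]
  have hrate := h.norm_le hN y gε (fun i j => by
      by_cases hij : i = j
      · simp [hij]
      · rw [hslack]
        exact (hε1 i j hij).le)
    (fun i => by
      rw [hstar]
      exact (hε2 i).le)
  have hyN : y = (N : ℝ) • gε N + ε • u := by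
    rw [hyε, hy, hy₁, hgε]
    module
  have hcert := hlam d y gε
  rw [sum_Icc_one_pred_eq fun k j =>
    lam k j * inner ℝ (formalX H y gε k - formalX H y gε j) (gε k - gε j)] at hcert
  have hsum : (∑ i : Fin N, ∑ j : Fin N, if j < i then lam (i + 1) (j + 1) *
      inner ℝ (formalX H y gε (i + 1) - formalX H y gε (j + 1)) (gε (i + 1) - gε (j + 1)) else 0) =
      ε * ∑ i, ∑ j, l i j * Q i j + ε ^ 2 * ∑ i, ∑ j, l i j * q i j := by
    simp only [mul_sum, ← sum_add_distrib]
    refine sum_congr rfl fun i _ => sum_congr rfl fun j _ => ?_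
    simp only [hl, hslack]
    split_ifs <;> ring
  have hs := hstar last
  rw [hlast] at hs
  rw [hsum, inner_sub_right, real_inner_comm, hs, hyN, inner_add_right, real_inner_smul_right,
    real_inner_smul_right, real_inner_self_eq_norm_sq] at hcert
  rw [hyN, norm_add_sq_real ((N : ℝ) • gε N), norm_smul, norm_smul, mul_pow, mul_pow,
    Real.norm_natCast, real_inner_smul_left, real_inner_smul_right, Real.norm_eq_abs,
    sq_abs] at hrate
  have e1 : ε * inner ℝ (gε N) u = ε * (1 + ∑ i, ∑ j, l i j * Q i j) + ε ^ 2 * κ := by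
    simp only [κ]
    linarith
  rw [e1] at hrate
  linarith

end Perturbation

end HMatrix

namespace HMatrix

open Finset

/-! ### The negacyclic worst case and necessity of the conditions. -/

section WorstCase

/-- The negacyclic shift of `n + 1` orthonormal vectors as a linear isometry of `ℝᵈ`. -/
theorem exists_negacyclic_shift {n d : ℕ} (hd : n + 1 ≤ d) :
    ∃ (T : Module.End ℝ (EuclideanSpace ℝ (Fin d))) (e : EuclideanSpace ℝ (Fin d)),
      (∀ x, ‖T x‖ = ‖x‖) ∧ (Orthonormal ℝ fun m : Fin (n + 1) => (T ^ (m : ℕ)) e) ∧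
        (T ^ (n + 1)) e = -e := by
  have : NeZero d := ⟨by omega⟩
  let c : Fin d := ⟨n, by omega⟩
  let σ : Equiv.Perm (Fin d) := Fin.cycleRange c
  let s : Fin d → ℝ := fun i => if i = c then -1 else 1
  let T : Module.End ℝ (EuclideanSpace ℝ (Fin d)) :=
    { toFun := fun v => WithLp.toLp 2 fun i => s i * v (σ i)
      map_add' := fun v w => by
        ext i
        simp [mul_add]
      map_smul' := fun a v => by
        ext i
        simp [mul_left_comm] }
  have hT : ∀ v i, T v i = s i * v (σ i) := fun v i => rfl
  -- Thus `T` lowers the index of a basis vector by one along the cycle, with a sign on the wrap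
  -- from `0` to `n`.
  have hs : ∀ j, T (EuclideanSpace.single (σ j) 1) = s j • EuclideanSpace.single j (1 : ℝ) := by
    intro j
    ext i
    rw [hT]
    by_cases hij : i = j
    · subst hij; simp
    · simp [hij]
  have hpow : ∀ m : ℕ, m ≤ n →
      (T ^ m) (EuclideanSpace.single c 1) = EuclideanSpace.single ⟨n - m, by omega⟩ (1 : ℝ) := by
    intro m hm
    induction m with
    | zero => simp [c]
    | succ m ih =>
      rw [pow_succ', Module.End.mul_apply, ih (by omega)]
      have h1 : (⟨n - (m + 1), by omega⟩ : Fin d) < c := by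
        rw [Fin.lt_def]
        change n - (m + 1) < n
        omega
      have h2 : (⟨n - m, by omega⟩ : Fin d) = σ ⟨n - (m + 1), by omega⟩ := by
        ext
        rw [Fin.coe_cycleRange_of_lt h1]
        change n - m = n - (m + 1) + 1
        omega
      rw [h2, hs]
      simp [s, h1.ne]
  refine ⟨T, EuclideanSpace.single c 1, fun v => ?_, ?_, ?_⟩
  · rw [EuclideanSpace.norm_eq, EuclideanSpace.norm_eq,
      ← Equiv.sum_comp σ fun i => ‖v i‖ ^ 2]
    congr 1
    refine sum_congr rfl fun i _ => ?_
    rw [hT, norm_mul]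
    have : ‖s i‖ = 1 := by
      simp only [s]
      split_ifs <;> simp
    rw [this, one_mul]
  · have h1 : (fun m : Fin (n + 1) => (T ^ (m : ℕ)) (EuclideanSpace.single c 1)) =
        (fun i => EuclideanSpace.single i (1 : ℝ)) ∘ fun m : Fin (n + 1) =>
          (⟨n - m, by omega⟩ : Fin d) := by
      ext1 m
      exact hpow m (by omega)
    rw [h1]
    refine EuclideanSpace.orthonormal_single.comp _ fun m m' h => ?_
    rw [Fin.mk.injEq] at h
    ext
    omega
  · have h2 : (⟨n - n, by omega⟩ : Fin d) = σ c := by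
      rw [Fin.cycleRange_self]
      ext
      simp
    rw [pow_succ', Module.End.mul_apply, hpow n le_rfl, h2, hs]
    simp [s]

variable {n : ℕ} (H : Matrix (Fin (n + 1 - 1)) (Fin (n + 1 - 1)) ℝ)
  {E : Type*} [NormedAddCommGroup E] [InnerProductSpace ℝ E] (T : Module.End ℝ E) (e : E)

/-- The starting point of the worst case for the shift `T` of `e`. -/
noncomputable def worstStart (n : ℕ) (T : Module.End ℝ E) (e : E) : E :=
  ∑ m ∈ range (n + 1), (T ^ m) e

/-- The halved residuals of the algorithm for `T` started at `worstStart n T e`. -/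
noncomputable def worstResidual (k : ℕ) : E :=
  ∑ m ∈ range (n + 1), P H (k - 1) m • ((T - 1) ^ m) e

variable {T e}

/-- Shows that `worstResidual` really is half the residual. The geometric sum telescopes to `(T - 1)
y₀ = -2 e`, and `P_succ` matches the update of the iterates. -/
theorem formalY_worst_sub (hTe : (T ^ (n + 1)) e = -e) {k : ℕ} (hk : k ≤ n) :
    formalY H (worstStart n T e) (worstResidual H T e) k -
      T (formalY H (worstStart n T e) (worstResidual H T e) k) =
      (2 : ℝ) • worstResidual H T e (k + 1) := by
  have h1 : (T - 1) (worstStart n T e) = -(2 : ℝ) • e := by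
    have h2 := congrArg (fun S : Module.End ℝ E => S e) (mul_geom_sum T (n + 1))
    simp only [Module.End.mul_apply, LinearMap.sub_apply, hTe, LinearMap.sum_apply,
      Module.End.one_apply] at h2
    rw [worstStart, LinearMap.sub_apply, Module.End.one_apply, h2]
    module
  have h3 : ∀ j, (T - 1) (worstResidual H T e j) =
      ∑ m ∈ range (n + 1), P H (j - 1) m • ((T - 1) ^ (m + 1)) e := by
    intro j
    rw [worstResidual, map_sum]
    refine sum_congr rfl fun m _ => ?_
    rw [map_smul, pow_succ', Module.End.mul_apply]
  have h4 : worstResidual H T e (k + 1) =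
      ∑ m ∈ range (n + 1), P H k (m + 1) • ((T - 1) ^ (m + 1)) e + e := by
    have h5 := sum_range_succ' (fun m => P H k m • ((T - 1) ^ m) e) (n + 1)
    rw [sum_range_succ, P_eq_zero_of_lt H (by omega : k < n + 1), zero_smul, add_zero] at h5
    rw [worstResidual, add_tsub_cancel_right, h5]
    simp
  have h6 : ∑ m ∈ range (n + 1), P H k (m + 1) • ((T - 1) ^ (m + 1)) e =
      ∑ i ∈ Icc 1 k, ∑ j ∈ Icc 1 i, entry H i j • (T - 1) (worstResidual H T e j) := by
    simp only [h3, P_succ, sum_smul, smul_sum, smul_smul]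
    rw [sum_comm]
    refine sum_congr rfl fun i _ => sum_comm
  have h7 : ∀ v : E, v - T v = -(T - 1) v := fun v => by
    rw [LinearMap.sub_apply, Module.End.one_apply, neg_sub]
  rw [h7, formalY, map_sub, h1, h4, h6]
  simp only [map_sum, map_smul, smul_add, smul_sum, smul_smul]
  module

/-- With `T` a linear isometry, this form makes every slack `(‖v‖² - ‖T v‖²)/4 = 0`. -/
theorem formalX_worst (hTe : (T ^ (n + 1)) e = -e) (i : Fin (n + 1)) :
    ∃ v, formalX H (worstStart n T e) (worstResidual H T e) (i + 1) = (1 / 2 : ℝ) • (v + T v) ∧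
      worstResidual H T e (i + 1) = (1 / 2 : ℝ) • (v - T v) := by
  have h := formalY_worst_sub H hTe (Nat.lt_succ_iff.1 i.2)
  refine ⟨formalY H (worstStart n T e) (worstResidual H T e) i, ?_, ?_⟩
  · rw [formalX, add_tsub_cancel_right]
    have h2 : worstResidual H T e (i + 1) = (1 / 2 : ℝ) • (2 : ℝ) • worstResidual H T e (i + 1) := by
      module
    rw [h2, ← h]
    module
  · rw [h]
    module

theorem inner_worst_eq_zero (hT : ∀ x, ‖T x‖ = ‖x‖) (hTe : (T ^ (n + 1)) e = -e)
    (i : Fin (n + 1)) :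
    inner ℝ (formalX H (worstStart n T e) (worstResidual H T e) (i + 1))
      (worstResidual H T e (i + 1)) = 0 := by
  obtain ⟨v, hv, hv'⟩ := formalX_worst H hTe i
  rw [hv, hv', inner_half_add_half_sub, hT, sub_self, zero_div]

theorem inner_worst_sub_eq_zero (hT : ∀ x, ‖T x‖ = ‖x‖) (hTe : (T ^ (n + 1)) e = -e)
    (i j : Fin (n + 1)) :
    inner ℝ (formalX H (worstStart n T e) (worstResidual H T e) (i + 1) -
      formalX H (worstStart n T e) (worstResidual H T e) (j + 1))
      (worstResidual H T e (i + 1) - worstResidual H T e (j + 1)) = 0 := by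
  obtain ⟨v, hv, hv'⟩ := formalX_worst H hTe i
  obtain ⟨w, hw, hw'⟩ := formalX_worst H hTe j
  rw [hv, hv', hw, hw', ← smul_sub, ← smul_sub, add_sub_add_comm, sub_sub_sub_comm, ← map_sub,
    inner_half_add_half_sub, hT, sub_self, zero_div]

open Polynomial

/-- The polynomial `p` with `worstResidual H T e (k + 1) = p(T) e`. -/
noncomputable def residualPoly (k : ℕ) : ℝ[X] := ∑ m ∈ range (n + 1), C (P H k m) * (X - 1) ^ m

theorem natDegree_X_sub_one_pow (m : ℕ) : ((X - 1 : ℝ[X]) ^ m).natDegree = m := by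
  rw [natDegree_pow, ← C_1, natDegree_X_sub_C, mul_one]

theorem natDegree_residualPoly_lt (k : ℕ) : (residualPoly H k).natDegree < n + 1 := by
  refine Nat.lt_succ_iff.2 (natDegree_sum_le_of_forall_le _ _ fun m hm => ?_)
  exact ((natDegree_C_mul_le _ _).trans (natDegree_X_sub_one_pow m).le).trans (Nat.lt_succ_iff.1 (mem_range.1 hm))

theorem worstResidual_eq_sum (k : ℕ) : worstResidual H T e (k + 1) =
    ∑ m : Fin (n + 1), (residualPoly H k).coeff m • (T ^ (m : ℕ)) e := by
  have h1 : aeval T (residualPoly H k) = ∑ m ∈ range (n + 1), P H k m • (T - 1) ^ m := by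
    simp [residualPoly, Algebra.smul_def]
  rw [aeval_eq_sum_range' (natDegree_residualPoly_lt H k)] at h1
  have h2 := congrArg (fun S : Module.End ℝ E => S e) h1
  simp only [LinearMap.sum_apply, LinearMap.smul_apply] at h2
  rw [worstResidual, add_tsub_cancel_right, ← h2,
    Fin.sum_univ_eq_sum_range fun m => (residualPoly H k).coeff m • (T ^ m) e]

theorem residualPoly_eval_one (k : ℕ) : (residualPoly H k).eval 1 = 1 := by
  simp [residualPoly, eval_finsetSum, sum_range_succ']

theorem residualPoly_coeff_eq_zero {k m : ℕ} (h : k < m) : (residualPoly H k).coeff m = 0 := by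
  rw [residualPoly, finsetSum_coeff]
  refine sum_eq_zero fun l _ => ?_
  rw [coeff_C_mul]
  rcases lt_or_ge k l with hl | hl
  · rw [P_eq_zero_of_lt H hl, zero_mul]
  · rw [coeff_eq_zero_of_natDegree_lt, mul_zero]
    rw [natDegree_X_sub_one_pow]
    omega

theorem residualPoly_coeff_self {k : ℕ} (hk : k ≤ n) :
    (residualPoly H k).coeff k = P H k k := by
  rw [residualPoly, finsetSum_coeff, sum_eq_single k]
  · rw [coeff_C_mul]
    have h1 := (monic_X_sub_C (1 : ℝ)).pow k
    have h2 := h1.coeff_natDegree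
    rw [C_1, natDegree_X_sub_one_pow] at h2
    rw [h2, mul_one]
  · intro l _ hl
    rw [coeff_C_mul]
    rcases lt_or_gt_of_ne hl with hl | hl
    · rw [coeff_eq_zero_of_natDegree_lt, mul_zero]
      rwa [natDegree_X_sub_one_pow]
    · rw [P_eq_zero_of_lt H hl, zero_mul]
  · intro h
    exact absurd (mem_range.2 (by omega)) h

/-- The coordinates of the residuals form a triangular matrix with diagonal `P(k,k)`, and `P(n,n) ≠
0` forces all of these to be nonzero. -/
theorem linearIndependent_worstResidual (hP : P H n n ≠ 0)
    (he : Orthonormal ℝ fun m : Fin (n + 1) => (T ^ (m : ℕ)) e) :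
    LinearIndependent ℝ fun i : Fin (n + 1) => worstResidual H T e (i + 1) := by
  let D : Matrix (Fin (n + 1)) (Fin (n + 1)) ℝ := Matrix.of fun i m => (residualPoly H i).coeff m
  have hD : D.det ≠ 0 := by
    rw [Matrix.det_of_isLowerTriangular D fun i j hij =>
      residualPoly_coeff_eq_zero H (show (i : ℕ) < j from hij), prod_ne_zero_iff]
    intro i _
    have hi := Nat.lt_succ_iff.1 i.2
    change (residualPoly H i).coeff i ≠ 0
    rw [residualPoly_coeff_self H hi]
    exact P_self_ne_zero H hP hi
  rw [Fintype.linearIndependent_iff]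
  intro c hc
  have h1 : ∑ m : Fin (n + 1), (Matrix.vecMul c D) m • (T ^ (m : ℕ)) e = 0 := by
    rw [← hc]
    simp only [worstResidual_eq_sum, Matrix.vecMul, dotProduct, sum_smul, smul_sum, smul_smul]
    exact sum_comm
  have h2 := Fintype.linearIndependent_iff.1 he.linearIndependent _ h1
  exact fun i => congrFun (Matrix.eq_zero_of_vecMul_eq_zero hD (funext h2)) i

variable {H}

/-- The coefficients sum to `1`, and the rate bounds their sum of squares by `1/(n+1)`: the equality
case of Cauchy–Schwarz. -/
theorem HasOptimalRate.residualPoly_coeff {d : ℕ} (hd : n + 1 ≤ d)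
    (h : HasOptimalRate (n + 1) d H) (m : Fin (n + 1)) :
    (residualPoly H n).coeff m = 1 / (n + 1 : ℝ) := by
  obtain ⟨T, e, hT, he, hTe⟩ := exists_negacyclic_shift hd
  have h1 := h.norm_le (by omega) (worstStart n T e) (worstResidual H T e)
    (fun i j => (inner_worst_sub_eq_zero H hT hTe i j).ge)
    (fun i => (inner_worst_eq_zero H hT hTe i).ge)
  set p : Fin (n + 1) → ℝ := fun m => (residualPoly H n).coeff m with hp
  have h2 : ‖worstResidual H T e (n + 1)‖ ^ 2 = ∑ m, p m ^ 2 := by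
    rw [worstResidual_eq_sum, ← real_inner_self_eq_norm_sq, he.inner_sum]
    simp [hp, sq]
  have h3 : ‖worstStart n T e‖ ^ 2 = n + 1 := by
    have h4 : worstStart n T e = ∑ m : Fin (n + 1), (1 : ℝ) • (T ^ (m : ℕ)) e := by
      simp only [one_smul]
      rw [worstStart, Fin.sum_univ_eq_sum_range fun m => (T ^ m) e]
    rw [h4, ← real_inner_self_eq_norm_sq, he.inner_sum]
    simp
  have h5 : ∑ m, p m = 1 := by
    rw [← residualPoly_eval_one H n, eval_eq_sum_range' (natDegree_residualPoly_lt H n),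
      ← Fin.sum_univ_eq_sum_range fun m => (residualPoly H n).coeff m * 1 ^ m]
    simp [hp]
  have hn : (0 : ℝ) < n + 1 := by positivity
  rw [h2, h3, Nat.cast_succ] at h1
  have h6 : ∑ m, p m ^ 2 ≤ 1 / (n + 1 : ℝ) := by
    rw [le_div_iff₀ hn]
    nlinarith
  have h7 : ∑ m, (p m - 1 / (n + 1 : ℝ)) ^ 2 ≤ 0 := by
    have h8 : ∑ m, (p m - 1 / (n + 1 : ℝ)) ^ 2 =
        ∑ m, p m ^ 2 - 2 / (n + 1 : ℝ) * ∑ m, p m + (n + 1) * (1 / (n + 1 : ℝ)) ^ 2 := by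
      simp only [sub_sq, sum_add_distrib, sum_sub_distrib, mul_sum]
      congr 1
      · congr 1
        exact sum_congr rfl fun m _ => by ring
      · simp
    rw [h8, h5]
    have : (n + 1) * (1 / (n + 1 : ℝ)) ^ 2 = 1 / (n + 1 : ℝ) := by field_simp
    rw [this, mul_one, show (2 : ℝ) / (n + 1) = 2 * (1 / (n + 1)) by ring]
    linarith
  have h9 := (sum_eq_zero_iff_of_nonneg fun m _ => sq_nonneg (p m - 1 / (n + 1 : ℝ))).1
    (le_antisymm h7 (sum_nonneg fun m _ => sq_nonneg _)) m (mem_univ m)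
  exact sub_eq_zero.1 (pow_eq_zero_iff two_ne_zero |>.1 h9)

theorem HasOptimalRate.invariance {d : ℕ} (hd : n + 1 ≤ d) (h : HasOptimalRate (n + 1) d H) :
    Invariance (n + 1) H := by
  intro m _ hm
  rw [add_tsub_cancel_right] at hm ⊢
  have h1 : residualPoly H n = ∑ i ∈ range (n + 1), C (1 / (n + 1 : ℝ)) * X ^ i := by
    conv_lhs => rw [(residualPoly H n).as_sum_range_C_mul_X_pow' (natDegree_residualPoly_lt H n)]
    refine sum_congr rfl fun i hi => ?_
    rw [h.residualPoly_coeff hd ⟨i, mem_range.1 hi⟩]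
  -- Substituting `X + 1` for `X` turns the powers of `X - 1` into monomials, exposing `P(n,m)`; the
  -- other side is a hockey-stick sum.
  have h2 := congrArg (fun p : ℝ[X] => (p.comp (X + 1)).coeff m) h1
  simp only [residualPoly, Polynomial.sum_comp, mul_comp, C_comp, pow_comp, sub_comp, X_comp, one_comp,
    add_sub_cancel_right, finsetSum_coeff, coeff_C_mul, coeff_X_pow, coeff_X_add_one_pow] at h2
  have h3 : ∑ i ∈ range (n + 1), i.choose m = (n + 1).choose (m + 1) := by
    rw [← Nat.sum_Icc_choose, range_eq_Ico]
    refine (sum_subset (fun i hi => ?_) fun i _ hi => Nat.choose_eq_zero_of_lt ?_).symm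
    · simp only [mem_Icc, mem_Ico] at hi ⊢
      omega
    · simp only [mem_Icc, mem_Ico] at *
      omega
  rw [← mul_sum, ← Nat.cast_sum, h3] at h2
  simpa [Nat.lt_succ_iff, hm] using h2

theorem HasOptimalRate.optimalityConditions {d : ℕ} (hd : n + 1 ≤ d)
    (h : HasOptimalRate (n + 1) d H) : OptimalityConditions (n + 1) H := by
  have hinv := h.invariance hd
  refine ⟨hinv, fun k j hk hkn hj hjk => ?_⟩
  obtain ⟨T, e, hT, he, hTe⟩ := exists_negacyclic_shift hd
  have hP : P H n n ≠ 0 := by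
    have h1 := hinv.P_eq le_rfl
    intro h0
    simp [h0] at h1
  -- Equal coefficients make `g_N` the average of the orbit, so the example is tight.
  have hy : worstStart n T e = ((n + 1 : ℕ) : ℝ) • worstResidual H T e (n + 1) := by
    have hn : (n + 1 : ℝ) ≠ 0 := by positivity
    rw [worstResidual_eq_sum, worstStart, smul_sum, ← Fin.sum_univ_eq_sum_range fun m => (T ^ m) e]
    refine sum_congr rfl fun m _ => ?_
    rw [h.residualPoly_coeff hd, smul_smul, Nat.cast_succ, mul_one_div_cancel hn, one_smul]
  have h1 := h.certificate_nonneg (by omega) (isCertificate_certificate hinv)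
    (linearIndependent_worstResidual H hP he) hy (inner_worst_sub_eq_zero H hT hTe)
    (inner_worst_eq_zero H hT hTe) (a := ⟨k - 1, by omega⟩) (b := ⟨j - 1, by omega⟩)
    (Fin.mk_lt_mk.2 (by omega))
  rwa [show k - 1 + 1 = k by omega, show j - 1 + 1 = j by omega] at h1

theorem OptimalityConditions.hasOptimalRate (h : OptimalityConditions (n + 1) H) (d : ℕ) :
    HasOptimalRate (n + 1) d H :=
  hasOptimalRate_of_isCertificate (by omega) (isCertificate_certificate h.1) h.2

end WorstCase

end HMatrix

/-! ### Assembly of the three claims. -/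

theorem mainTheorem1 (N : ℕ) (hN : 1 ≤ N)
    (H : Matrix (Fin (N - 1)) (Fin (N - 1)) ℝ) (hH : ∀ a b, a < b → H a b = 0) :
    -- the H-certificates are well defined under the H-invariance conditions
    (HMatrix.Invariance N H →
      HMatrix.IsCertificate N H (HMatrix.certificate N H) ∧
        ∀ lam : ℕ → ℕ → ℝ, HMatrix.IsCertificate N H lam →
          ∀ k j : ℕ, 2 ≤ k → k ≤ N → 1 ≤ j → j ≤ k - 1 →
            lam k j = HMatrix.certificate N H k j) ∧
    -- the optimal rate in all dimensions
    ((∀ d : ℕ, HMatrix.HasOptimalRate N d H) ↔ HMatrix.OptimalityConditions N H) ∧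
    -- the optimal rate in a fixed dimension that is not too small
    (∀ d : ℕ, N + 1 ≤ d →
      (HMatrix.HasOptimalRate N d H ↔ HMatrix.OptimalityConditions N H)) := by
  obtain ⟨n, rfl⟩ := Nat.exists_eq_add_of_le' hN
  refine ⟨fun hinv => ?_, ⟨fun h => ?_, fun h d => h.hasOptimalRate d⟩, fun d hd =>
    ⟨fun h => h.optimalityConditions (by omega), fun h => h.hasOptimalRate d⟩⟩
  · have hcert := HMatrix.isCertificate_certificate hinv
    refine ⟨hcert, fun lam hlam k j hk hkn hj hjk => ?_⟩
    have h1 := hlam.unique hcert ⟨k - 1, by omega⟩ ⟨j - 1, by omega⟩ (Fin.mk_lt_mk.2 (by omega))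
    rwa [show k - 1 + 1 = k by omega, show j - 1 + 1 = j by omega] at h1
  -- The single dimension `d = N` suffices here.
  · exact (h (n + 1)).optimalityConditions le_rfl
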